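/- Let $(\Omega,\mathscr F,\mathbb P)$ and $(\mathbb X,\mathsf F,\mu)$ be probability spaces. For each $d\in\mathbb N=\{1,2,\dots\}$ let $X^{(d)}=(X^{(d)}_1,\dots,X^{(d)}_d)$ be a random vector in $\mathbb R^d$ such that (a) $\mathbb E X^{(d)}=0$ and $\mathbb E\|X^{(d)}\|_2^2=1$ for all $d$; (b) $\mathbb E[X^{(d)}_aX^{(d)}_{a'}]=0$ for all $d$ and all $a\neq a'$ in $\{1,\dots,d\}$; (c) $\lim_{c\to\infty}\sup_{d\in\mathbb N}\mathbb E\big[\|X^{(d)}\|_2^2\,\mathbf 1_{\{\|X^{(d)}\|_2^2>c\}}\big]=0$; (d) $\lim_{d\to\infty}\max_{1\le a\le d}\mathbb E(X^{(d)}_a)^2=0$. Let $(U(j))_{j\ge1}$ be i.i.d. random elements of $\mathbb X$ with distribution $\mu$ and, for each $d$, let $(X^{(d)}(j))_{j\ge 1}$ be i.i.d. copies of $X^{(d)}$ such that the sequence $(X^{(d)}(j))_{j\ge1}$ is independent of $(U(j))_{j\ge1}$. For $A\in\mathsf F$ and $n\in\mathbb N$ put $$S^{(d)}_n(A)=\sum_{j=1}^n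 X^{(d)}(j)\,\mathbf 1_{\{U(j)\in A\}} .$$ Let $\mathcal M\subset\mathsf F$ be a Vapnik–Chervonenkis (VC) class, that is, there is $k\in\mathbb N$ such that no subset $I\subset\mathbb X$ with exactly $k+1$ elements is shattered by $\mathcal M$ (where $I$ is shattered if every $J\subset I$ has the form $I\cap A$ with $A\in\mathcal M$). Assume that $\mathcal M$ satisfies the usual measurability condition: for all $n\in\mathbb N$ and $J\subset\{1,\dots,n\}$, the set of those $(u_1,\dots,u_n)\in\mathbb X^n$ for which there is $A\in\mathcal M$ with $\{i: u_i\in A\}=J$ is measurable with respect to the completion of $\mu^{\otimes n}$ (this is automatic, for instance, if $\mathcal M$ is countable, or if $\mathcal M$ has a countable subfamily such that the indicator of each $A\in\mathcal M$ is a pointwise limit of indicators of sets from the subfamily). Theorem. Let $n=n(d)$ be an arbitrary sequence of positive integers with $n(d)\to\infty$ as $d\to\infty$. Then $$\sup_{A\in\mathcal M}\Big|\,n^{-1/2}\big\|S^{(d)}_{n}(A)\big\|_2-\mu(A)^{1/2}\Big|\ \overset{\mathbb P}{\longrightarrow}\ 0\qquad\text{as } d\to\infty ,$$ where convergence in probability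 is understood in outer probability in case the supremum is not measurable. -/

import Mathlib

open MeasureTheory ProbabilityTheory Filter
open scoped Topology ENNReal

namespace SetIndexed

/-- The family `𝓜` of subsets of `𝕏` shatters the finite set `I`: every `J ⊆ I` is of the form
`I ∩ A` with `A ∈ 𝓜`. -/
def Shatters {𝕏 : Type*} (𝓜 : Set (Set 𝕏)) (I : Finset 𝕏) : Prop :=
  ∀ J : Set 𝕏, J ⊆ (I : Set 𝕏) → ∃ A ∈ 𝓜, (I : Set 𝕏) ∩ A = J

/-- `𝓜` is a Vapnik–Chervonenkis class: for some `n`, no set of size `n + 1` is shattered. -/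
def IsVCClass {𝕏 : Type*} (𝓜 : Set (Set 𝕏)) : Prop :=
  ∃ n : ℕ, ∀ I : Finset 𝕏, I.card = n + 1 → ¬ Shatters 𝓜 I

/-- Measurability of the class `𝓜` with respect to i.i.d. samples from `μ`: for every sample size
`n` and every index set `J`, the set of samples `(u₁, …, uₙ)` from which some member of `𝓜` picks
out exactly the points with index in `J` is measurable for the completion of `μⁿ`. It holds for
countable and for pointwise separable classes (in particular rectangles or half-spaces), and for
image admissible Suslin classes. -/
def IsSampleMeasurable {𝕏 : Type*} [MeasurableSpace 𝕏] (𝓜 : Set (Set 𝕏)) (μ : Measure 𝕏) : Prop :=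
  ∀ (n : ℕ) (J : Set (Fin n)),
    NullMeasurableSet {u : Fin n → 𝕏 | ∃ A ∈ 𝓜, {i | u i ∈ A} = J} (Measure.pi fun _ => μ)

/-- Conditions (a)–(d) on the generic increments `ξ d` in `ℝ^d`, `d ≥ 1`. -/
structure IncrementConditions {Ω : Type*} [MeasurableSpace Ω] (P : Measure Ω)
    (ξ : (d : ℕ) → Ω → EuclideanSpace ℝ (Fin d)) : Prop where
  /-- (a), first part: the increments are centred. -/
  centered : ∀ d : ℕ, 1 ≤ d → ∫ ω, ξ d ω ∂P = 0
  /-- (a), second part: the increments are normalised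
  (the value `1` forces the integrand to be integrable). -/
  normalized : ∀ d : ℕ, 1 ≤ d → ∫ ω, ‖ξ d ω‖ ^ 2 ∂P = 1
  /-- (b): the components are mutually uncorrelated. -/
  uncorrelated : ∀ (d : ℕ) (a a' : Fin d), a ≠ a' → ∫ ω, ξ d ω a * ξ d ω a' ∂P = 0
  /-- (c): the squared norms are uniformly integrable
  (the index `d = 0` contributes nothing to the supremum). -/
  uniformlyIntegrable :
    Tendsto (fun c : ℝ => ⨆ d : ℕ, ∫⁻ ω in {ω | c < ‖ξ d ω‖ ^ 2}, ENNReal.ofReal (‖ξ d ω‖ ^ 2) ∂P)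
      atTop (𝓝 0)
  /-- (d): the individual components are negligible (a maximum over finitely many indices). -/
  negligible :
    Tendsto (fun d : ℕ => ⨆ a : Fin d, ∫ ω, (ξ d ω a) ^ 2 ∂P) atTop (𝓝 0)

/-- The set-indexed sum `S_n(A) = ∑_{j < n} X(j) 𝟙{U(j) ∈ A}`; the summands are numbered from `0`
to `n - 1`. -/
noncomputable def setIndexedSum {Ω 𝕏 E : Type*} [AddCommMonoid E]
    (X : ℕ → Ω → E) (U : ℕ → Ω → 𝕏) (n : ℕ) (A : Set 𝕏) (ω : Ω) : E :=
  ∑ j ∈ Finset.range n, A.indicator (fun _ => X j ω) (U j ω)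

end SetIndexed

/-!
Write `μₙ A` for the fraction of the first `n` sample points `U j` that lie in `A`. The difference
`n ^ (-1 / 2) * ‖S A‖ - √(μ A)` is split at `√(μₙ A)`.

That `μₙ` is uniformly close to `μ` on a Vapnik–Chervonenkis class is the classical law of large
numbers (`measure_exists_le_abs_card_sub_le`): a second, independent sample replaces `μ`, random
exchanges between the two samples introduce signs, and by the Sauer–Shelah lemma only polynomially
many traces of the class on the two samples matter.

For the remaining difference one may condition on the sample, as the increments are independent of
it; the class then becomes a deterministic family `T` of index sets of bounded VC dimension
(`measure_mem_traces_le`). For a single index set `J`, `‖∑ i ∈ J, X i‖ ^ 2` is close to `|J|`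
(`lintegral_abs_sq_norm_sum_sub_card_le`): the diagonal terms obey a weak law of large numbers by
uniform integrability, and the cross terms have second moment at most `2 * τ * |J| ^ 2`, where `τ`
is the largest variance of a component, which tends to zero. A finite net of `T` in the counting
distance, whose size does not depend on `n` (`exists_net`), reduces the supremum over `T` to
finitely many `J` and a modulus of continuity.

The modulus of continuity is controlled by symmetrization and chaining. Rademacher sums in a Hilbert
space are sub-Gaussian with dimension-free constants (`expect_exp_norm_signedSum_le`), so Dudley's
entropy bound gives a modulus that depends on the VC dimension only
(`exists_majorant_of_vcDim_le`). Chaining takes place in the distance `∑ i ∈ J ∆ J', ‖X i‖ ^ 2`,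
which is random; increments with `‖X i‖ ^ 2 ≤ c` are therefore treated with constant weights, hence
in the counting distance, and the others contribute little because their weights have small total
mass by uniform integrability (`lintegral_iSup_enorm_sub_le`).

Suprema over the class are treated through the traces on the sample, of which there are finitely
many; null-measurability of the events that a given trace occurs is all the measurability required.
-/

/-! ### Traces of a Vapnik–Chervonenkis class and their metric entropy -/

namespace SetIndexed

open scoped Classical in
/-- The traces of the family `𝓜` on the sample `u`: all index sets `{i | u i ∈ A}`, `A ∈ 𝓜`. -/
noncomputable def traces {𝕏 ι : Type*} [Fintype ι] (𝓜 : Set (Set 𝕏)) (u : ι → 𝕏) :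
    Finset (Finset ι) :=
  Finset.univ.filter fun J => ∃ A ∈ 𝓜, {i | u i ∈ A} = (J : Set ι)

theorem mem_traces {𝕏 ι : Type*} [Fintype ι] {𝓜 : Set (Set 𝕏)} {u : ι → 𝕏} {J : Finset ι} :
    J ∈ traces 𝓜 u ↔ ∃ A ∈ 𝓜, {i | u i ∈ A} = (J : Set ι) := by
  simp [traces]

theorem exists_mem_traces {𝕏 ι : Type*} [Fintype ι] {𝓜 : Set (Set 𝕏)} (u : ι → 𝕏) {A : Set 𝕏}
    (hA : A ∈ 𝓜) : ∃ J ∈ traces 𝓜 u, ∀ i, i ∈ J ↔ u i ∈ A := by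
  classical
  exact ⟨Finset.univ.filter fun i => u i ∈ A, mem_traces.2 ⟨A, hA, by ext; simp⟩, by simp⟩

/-- Shattered sets of indices are sampled injectively from shattered sets of points. -/
theorem vcDim_traces_le {𝕏 ι : Type*} [Fintype ι] [DecidableEq ι] {𝓜 : Set (Set 𝕏)} {k : ℕ}
    (h : ∀ I : Finset 𝕏, I.card = k + 1 → ¬ Shatters 𝓜 I) (u : ι → 𝕏) :
    (traces 𝓜 u).vcDim ≤ k := by
  classical
  by_contra! hk
  obtain ⟨I, hI, hkI⟩ := (Finset.lt_sup_iff (f := Finset.card)).1 hk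
  rw [Finset.mem_shatterer] at hI
  obtain ⟨I', hI'I, hcard⟩ := Finset.exists_subset_card_eq (Nat.succ_le_of_lt hkI)
  replace hI := hI.mono_right hI'I
  -- `u` is injective on `I'`, as some trace contains `i` and no other point of `I'`
  have hinj : Set.InjOn u I' := by
    intro i hi j hj hij
    obtain ⟨J, hJ, hJi⟩ := hI.exists_inter_eq_singleton hi
    obtain ⟨A, -, hA⟩ := mem_traces.1 hJ
    have hmem : ∀ a, a ∈ J ↔ u a ∈ A := fun a => by
      rw [← Finset.mem_coe, ← hA]; rfl
    have hi' : i ∈ I' ∩ J := by rw [hJi]; simp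
    have hj' : j ∈ I' ∩ J := by
      rw [Finset.mem_inter]
      exact ⟨hj, (hmem j).2 (hij ▸ (hmem i).1 (Finset.mem_inter.1 hi').2)⟩
    rw [hJi, Finset.mem_singleton] at hj'
    exact hj'.symm
  refine h (I'.image u) (by rw [Finset.card_image_of_injOn hinj, hcard]) fun J hJ => ?_
  obtain ⟨K, hK, hKI⟩ := hI (Finset.filter_subset (fun i => u i ∈ J) I')
  obtain ⟨A, hA, hAK⟩ := mem_traces.1 hK
  refine ⟨A, hA, ?_⟩
  have hmem : ∀ a ∈ I', u a ∈ A ↔ u a ∈ J := fun a ha => by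
    have h1 : a ∈ I' ∩ K ↔ a ∈ I'.filter fun i => u i ∈ J := by rw [hKI]
    have h2 : a ∈ K ↔ u a ∈ A := by rw [← Finset.mem_coe, ← hAK]; rfl
    simp only [Finset.mem_inter, Finset.mem_filter, ha, true_and, h2] at h1
    exact h1
  ext x
  constructor
  · rintro ⟨hx, hxA⟩
    obtain ⟨a, ha, rfl⟩ := Finset.mem_image.1 (Finset.mem_coe.1 hx)
    exact (hmem a ha).1 hxA
  · intro hx
    have hx' := hJ hx
    obtain ⟨a, ha, rfl⟩ := Finset.mem_image.1 (Finset.mem_coe.1 hx')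
    exact ⟨hx', (hmem a ha).2 hx⟩

/-- Polynomial growth of set families of bounded VC dimension, from the Sauer–Shelah lemma. -/
theorem card_le_pow_of_vcDim_le {ι : Type*} [Fintype ι] [DecidableEq ι] {T : Finset (Finset ι)}
    {k : ℕ} (hT : T.vcDim ≤ k) : T.card ≤ (Fintype.card ι + 1) ^ k := by
  calc T.card ≤ ∑ j ∈ Finset.Iic T.vcDim, (Fintype.card ι).choose j :=
        T.card_le_card_shatterer.trans Finset.card_shatterer_le_sum_vcDim
    _ ≤ ∑ j ∈ Finset.range (k + 1), (Fintype.card ι).choose j := by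
        refine Finset.sum_le_sum_of_subset fun j hj => ?_
        rw [Finset.mem_Iic] at hj
        rw [Finset.mem_range]
        omega
    _ ≤ ∑ j ∈ Finset.range (k + 1), (Fintype.card ι) ^ j * 1 ^ (k - j) * k.choose j := by
        refine Finset.sum_le_sum fun j hj => ?_
        rw [one_pow, mul_one]
        have h1 : 1 ≤ k.choose j :=
          Nat.choose_pos (Nat.lt_succ_iff.1 (Finset.mem_range.1 hj))
        calc (Fintype.card ι).choose j ≤ (Fintype.card ι) ^ j := Nat.choose_le_pow _ _
          _ ≤ _ := Nat.le_mul_of_pos_right _ h1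
    _ = (Fintype.card ι + 1) ^ k := by rw [add_pow]; simp

/-- The sampling step in Dudley's packing bound: if the members of `T` are `ε`-separated for the
probability weights `w / ∑ w` and `l` draws from these weights fail to separate a given pair with
probability less than `1 / |T| ^ 2`, then some sample of size `l` separates all members of `T`. -/
theorem card_le_pow_of_separated {ι : Type*} [Fintype ι] [DecidableEq ι] {T : Finset (Finset ι)}
    {k : ℕ} (hT : T.vcDim ≤ k) {w : ι → ℝ} (hw : ∀ i, 0 ≤ w i) (hW : 0 < ∑ i, w i) {ε : ℝ}
    (hsep : ∀ J ∈ T, ∀ J' ∈ T, J ≠ J' → ε * ∑ i, w i < ∑ i ∈ symmDiff J J', w i)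
    {l : ℕ} (hl : (T.card : ℝ) ^ 2 * (1 - ε) ^ l < 1) (hε : ε ≤ 1) :
    T.card ≤ (l + 1) ^ k := by
  classical
  set W := ∑ i, w i with hWdef
  obtain ⟨s, hs⟩ : ∃ s : Fin l → ι, ∀ J ∈ T, ∀ J' ∈ T, J ≠ J' → ∃ a, s a ∈ symmDiff J J' := by
    by_contra! hcon
    have h1 : W ^ l ≤ ∑ p ∈ T.offDiag, (∑ i, if i ∈ symmDiff p.1 p.2 then 0 else w i) ^ l := by
      rw [hWdef, Fintype.sum_pow]
      simp_rw [Fintype.sum_pow]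
      rw [Finset.sum_comm]
      refine Finset.sum_le_sum fun s _ => ?_
      obtain ⟨J, hJ, J', hJ', hne, hnot⟩ := hcon s
      have hnn : ∀ p ∈ T.offDiag,
          0 ≤ ∏ a, (if s a ∈ symmDiff p.1 p.2 then 0 else w (s a)) := fun p _ =>
        Finset.prod_nonneg fun a _ => by split_ifs <;> simp [hw]
      refine le_trans (le_of_eq ?_)
        (Finset.single_le_sum hnn (Finset.mem_offDiag.2 ⟨hJ, hJ', hne⟩ : (J, J') ∈ _))
      exact Finset.prod_congr rfl fun a _ => by simp [hnot a]
    have h2 : ∀ p ∈ T.offDiag, (∑ i, if i ∈ symmDiff p.1 p.2 then 0 else w i) ^ l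
        ≤ ((1 - ε) * W) ^ l := by
      intro p hp
      rw [Finset.mem_offDiag] at hp
      refine pow_le_pow_left₀ (Finset.sum_nonneg fun i _ => by split_ifs <;> simp [hw]) ?_ _
      have h3 := hsep p.1 hp.1 p.2 hp.2.1 hp.2.2
      have h4 : (∑ i, if i ∈ symmDiff p.1 p.2 then 0 else w i)
          + ∑ i ∈ symmDiff p.1 p.2, w i = W := by
        have h5 : ∑ i ∈ symmDiff p.1 p.2, w i
            = ∑ i, if i ∈ symmDiff p.1 p.2 then w i else 0 := by
          rw [Finset.sum_ite_mem, Finset.univ_inter]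
        rw [h5, ← Finset.sum_add_distrib]
        exact Finset.sum_congr rfl fun i _ => by split_ifs <;> simp
      nlinarith
    have h3 : W ^ l ≤ (T.card : ℝ) ^ 2 * ((1 - ε) * W) ^ l := by
      refine h1.trans ((Finset.sum_le_sum h2).trans ?_)
      rw [Finset.sum_const, nsmul_eq_mul]
      refine mul_le_mul_of_nonneg_right ?_ (pow_nonneg (mul_nonneg (by linarith) hW.le) _)
      rw [Finset.offDiag_card]
      exact_mod_cast (Nat.sub_le _ _).trans (by rw [sq])
    rw [mul_pow, ← mul_assoc] at h3
    have := pow_pos hW l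
    nlinarith
  -- the traces of `T` on the sample `s` are distinct
  set f : Finset ι → Finset (Fin l) := fun J => Finset.univ.filter fun a => s a ∈ J with hf
  have hinj : Set.InjOn f T := by
    intro J hJ J' hJ' hJJ'
    by_contra hne
    obtain ⟨a, ha⟩ := hs J hJ J' hJ' hne
    have h1 : a ∈ f J ↔ a ∈ f J' := by rw [hJJ']
    simp only [hf, Finset.mem_filter, Finset.mem_univ, true_and] at h1
    rw [Finset.mem_symmDiff] at ha
    tauto
  have himage : T.image f = traces {A : Set ι | ∃ J ∈ T, (J : Set ι) = A} s := by
    ext K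
    rw [mem_traces, Finset.mem_image]
    constructor
    · rintro ⟨J, hJ, rfl⟩
      exact ⟨J, ⟨J, hJ, rfl⟩, by ext; simp [hf]⟩
    · rintro ⟨-, ⟨J, hJ, rfl⟩, hK⟩
      refine ⟨J, hJ, ?_⟩
      rw [← Finset.coe_inj, ← hK]
      ext
      simp [hf]
  have hdim : (T.image f).vcDim ≤ k := by
    rw [himage]
    refine vcDim_traces_le (fun I hI hsh => ?_) s
    have : T.Shatters I := by
      intro J hJ
      obtain ⟨-, ⟨K, hK, rfl⟩, hKJ⟩ := hsh J (by exact_mod_cast hJ)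
      exact ⟨K, hK, by exact_mod_cast hKJ⟩
    have := this.card_le_vcDim
    omega
  have := card_le_pow_of_vcDim_le hdim
  rwa [Finset.card_image_of_injOn hinj, Fintype.card_fin] at this

/-- A constant such that families of VC dimension at most `k` have packing numbers at most
`exp (entropyConst k * (i + 1))` at scale `2⁻¹ ^ i`. -/
noncomputable def entropyConst (k : ℕ) : ℝ := 1 + 2 * k * Real.log (4 * (k + 1)) + 2 * k

theorem entropyConst_pos (k : ℕ) : 0 < entropyConst k := by
  have : 0 ≤ Real.log (4 * (k + 1)) :=
    Real.log_nonneg (by linarith [(Nat.cast_nonneg k : (0 : ℝ) ≤ k)])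
  unfold entropyConst
  positivity

/-- Dudley's packing bound. With `L = log |T|`, samples of size `2 * L / ε` separate all members of
`T`, so that `L ≤ k * log ((2 * L + 2) / ε)`; this self-bounding inequality is solved for `L`. -/
theorem card_le_exp_of_separated {ι : Type*} [Fintype ι] [DecidableEq ι] {T : Finset (Finset ι)}
    {k : ℕ} (hT : T.vcDim ≤ k) {w : ι → ℝ} (hw : ∀ i, 0 ≤ w i) (hW : 0 < ∑ i, w i) (i : ℕ)
    (hsep : ∀ J ∈ T, ∀ J' ∈ T, J ≠ J' → (2⁻¹ : ℝ) ^ i * ∑ i, w i < ∑ i ∈ symmDiff J J', w i) :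
    (T.card : ℝ) ≤ Real.exp (entropyConst k * (i + 1)) := by
  have hC := entropyConst_pos k
  rcases T.eq_empty_or_nonempty with rfl | hne
  · simpa using (Real.exp_pos _).le
  set m := (T.card : ℝ) with hm
  have hm1 : 1 ≤ m := by rw [hm]; exact_mod_cast hne.card_pos
  set ε : ℝ := (2⁻¹ : ℝ) ^ i with hεdef
  have hε0 : 0 < ε := by positivity
  have hε1 : ε ≤ 1 := pow_le_one₀ (by norm_num) (by norm_num)
  set L := Real.log m with hL
  have hL0 : 0 ≤ L := Real.log_nonneg hm1
  have hmL : m = Real.exp L := (Real.exp_log (by linarith)).symm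
  set l := ⌊2 * L / ε⌋₊ + 1 with hl
  have hl1 : 2 * L < ε * l := by
    have := Nat.lt_floor_add_one (2 * L / ε)
    rw [div_lt_iff₀ hε0] at this
    rw [hl]; push_cast; linarith
  have hl2 : (l : ℝ) + 1 ≤ (2 * L + 2) * ε⁻¹ := by
    have h1 : (⌊2 * L / ε⌋₊ : ℝ) ≤ 2 * L * ε⁻¹ := by
      rw [← div_eq_mul_inv]
      exact Nat.floor_le (by positivity)
    have h2 : (1 : ℝ) ≤ ε⁻¹ := (one_le_inv₀ hε0).2 hε1
    rw [hl]; push_cast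
    linarith
  have hfail : m ^ 2 * (1 - ε) ^ l < 1 := by
    have h1 : (1 - ε) ^ l ≤ Real.exp (-(ε * l)) := by
      rw [show -(ε * l) = l * (-ε) by ring, Real.exp_nat_mul]
      exact pow_le_pow_left₀ (by linarith) (by linarith [Real.add_one_le_exp (-ε)]) _
    calc m ^ 2 * (1 - ε) ^ l ≤ Real.exp (2 * L) * Real.exp (-(ε * l)) := by
          rw [hmL, ← Real.exp_nat_mul]
          push_cast
          exact mul_le_mul_of_nonneg_left h1 (Real.exp_pos _).le
      _ < 1 := by rw [← Real.exp_add, Real.exp_lt_one_iff]; linarith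
  have hcard : m ≤ ((l : ℝ) + 1) ^ k := by
    rw [hm]; exact_mod_cast card_le_pow_of_separated hT hw hW hsep hfail hε1
  have hk0 : (0 : ℝ) ≤ k := Nat.cast_nonneg k
  have hlog1 : L ≤ k * Real.log ((2 * L + 2) * ε⁻¹) := by
    rw [hL, ← Real.log_pow]
    refine Real.log_le_log (by linarith) (hcard.trans ?_)
    exact pow_le_pow_left₀ (by positivity) hl2 _
  have hlogε : Real.log ε⁻¹ ≤ i := by
    rw [hεdef, ← inv_pow, inv_inv, Real.log_pow]
    have := Real.log_two_lt_d9
    have hi : (0 : ℝ) ≤ i := Nat.cast_nonneg i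
    nlinarith
  -- the logarithm is below its tangent line at `4 (k + 1)`
  have hlog2 : Real.log (2 * L + 2) ≤ (2 * L + 2) / (4 * (k + 1)) + Real.log (4 * (k + 1)) := by
    have h4 : (0 : ℝ) < 4 * (k + 1) := by positivity
    have h5 : (0 : ℝ) < (2 * L + 2) / (4 * (k + 1)) := by positivity
    have h6 := Real.log_le_sub_one_of_pos h5
    rw [Real.log_div (by positivity) h4.ne'] at h6
    linarith
  have hk4 : k * ((2 * L + 2) / (4 * (k + 1))) ≤ (L + 1) / 2 := by
    rw [mul_div_assoc', div_le_div_iff₀ (by positivity) (by norm_num)]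
    nlinarith
  rw [Real.log_mul (by positivity) (by positivity)] at hlog1
  have hfin : L ≤ entropyConst k * (i + 1) := by
    have hi : (0 : ℝ) ≤ i := Nat.cast_nonneg i
    have hlk : 0 ≤ Real.log (4 * ((k : ℝ) + 1)) := Real.log_nonneg (by linarith)
    have h7 : k * Real.log (2 * L + 2)
        ≤ k * ((2 * L + 2) / (4 * (k + 1)) + Real.log (4 * (k + 1))) :=
      mul_le_mul_of_nonneg_left hlog2 hk0
    have h8 : k * Real.log ε⁻¹ ≤ k * i := mul_le_mul_of_nonneg_left hlogε hk0
    have h9 : 0 ≤ k * Real.log (4 * ((k : ℝ) + 1)) := by positivity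
    have h10 : 0 ≤ k * Real.log (4 * ((k : ℝ) + 1)) * i := by positivity
    unfold entropyConst
    nlinarith
  rw [hmL]
  exact Real.exp_le_exp.2 hfin

/-- The net is a maximal separated subfamily. -/
theorem exists_net {ι : Type*} [Fintype ι] [DecidableEq ι] {T : Finset (Finset ι)}
    {k : ℕ} (hT : T.vcDim ≤ k) {w : ι → ℝ} (hw : ∀ i, 0 ≤ w i) (hW : 0 < ∑ i, w i) (i : ℕ) :
    ∃ N ⊆ T, (N.card : ℝ) ≤ Real.exp (entropyConst k * (i + 1)) ∧
      ∀ J ∈ T, ∃ J' ∈ N, ∑ a ∈ symmDiff J J', w a ≤ (2⁻¹ : ℝ) ^ i * ∑ a, w a := by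
  classical
  set S := T.powerset.filter fun N => ∀ J ∈ N, ∀ J' ∈ N, J ≠ J' →
    (2⁻¹ : ℝ) ^ i * ∑ i, w i < ∑ i ∈ symmDiff J J', w i with hS
  obtain ⟨N, hNS, hmax⟩ := S.exists_max_image Finset.card ⟨∅, by simp [hS]⟩
  rw [hS, Finset.mem_filter, Finset.mem_powerset] at hNS
  refine ⟨N, hNS.1, card_le_exp_of_separated ((Finset.vcDim_mono hNS.1).trans hT) hw hW i hNS.2,
    fun J hJ => ?_⟩
  by_contra! hcon
  have hJN : J ∉ N := fun h => by
    have := hcon J h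
    rw [symmDiff_self, Finset.bot_eq_empty, Finset.sum_empty] at this
    have h2 : 0 < (2⁻¹ : ℝ) ^ i * ∑ a, w a := by positivity
    linarith
  have hins : insert J N ∈ S := by
    rw [hS, Finset.mem_filter, Finset.mem_powerset]
    refine ⟨Finset.insert_subset hJ hNS.1, fun A hA B hB hAB => ?_⟩
    rcases Finset.mem_insert.1 hA with rfl | hA <;> rcases Finset.mem_insert.1 hB with rfl | hB
    · exact absurd rfl hAB
    · exact hcon B hB
    · rw [symmDiff_comm]; exact hcon A ‹_›
    · exact hNS.2 A hA B hB hAB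
  have := hmax _ hins
  rw [Finset.card_insert_of_notMem hJN] at this
  omega

/-! ### Rademacher sums in inner product spaces -/

/-- The Rademacher sum `∑ σ i • y i` of the vectors `y i` with signs `σ i`. -/
def signedSum {ι E : Type*} [Fintype ι] [AddCommGroup E] [Module ℝ E] (σ : ι → ℤˣ) (y : ι → E) :
    E :=
  ∑ i, ((σ i : ℤ) : ℝ) • y i

/-- Among pairs with a given sum, `A ^ n + B ^ n` increases with the distance of `A` and `B`. -/
theorem pow_add_pow_le_of_mem_Icc {A B A' B' : ℝ} (hB' : 0 ≤ B') (hA : B' ≤ A) (hA' : A ≤ A')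
    (h : A + B = A' + B') (n : ℕ) : A ^ n + B ^ n ≤ A' ^ n + B' ^ n := by
  rcases eq_or_lt_of_le (hA.trans hA') with heq | hlt
  · have h1 : A = A' := by linarith
    have h2 : B = B' := by linarith
    rw [h1, h2]
  · set θ := (A - B') / (A' - B') with hθ
    have hpos : 0 < A' - B' := by linarith
    have hθ0 : 0 ≤ θ := div_nonneg (by linarith) hpos.le
    have hθ1 : 0 ≤ 1 - θ := by
      rw [sub_nonneg, hθ, div_le_one hpos]
      linarith
    have hθm : θ * (A' - B') = A - B' := div_mul_cancel₀ _ hpos.ne'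
    have hconv := (convexOn_pow (𝕜 := ℝ) n).2
    have h1 := hconv (Set.mem_Ici.2 (hB'.trans (hA.trans hA'))) (Set.mem_Ici.2 hB') hθ0 hθ1
      (by ring)
    have h2 := hconv (Set.mem_Ici.2 (hB'.trans (hA.trans hA'))) (Set.mem_Ici.2 hB') hθ1 hθ0
      (by ring)
    simp only [smul_eq_mul] at h1 h2
    rw [show θ * A' + (1 - θ) * B' = A by linarith] at h1
    rw [show (1 - θ) * A' + θ * B' = B by linarith] at h2
    linarith

/-- The parallelogram identity fixes `‖u + x‖ ^ 2 + ‖u - x‖ ^ 2`, and `cosh (√s)` is a power series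
in `s` with nonnegative coefficients, hence convex; so the left side is largest for collinear
vectors, where equality holds. -/
theorem cosh_norm_add_add_cosh_norm_sub_le {E : Type*} [NormedAddCommGroup E]
    [InnerProductSpace ℝ E] (u x : E) :
    Real.cosh ‖u + x‖ + Real.cosh ‖u - x‖ ≤ 2 * Real.cosh ‖u‖ * Real.cosh ‖x‖ := by
  have hprod : 2 * Real.cosh ‖u‖ * Real.cosh ‖x‖
      = Real.cosh (‖u‖ + ‖x‖) + Real.cosh (‖u‖ - ‖x‖) := by
    rw [Real.cosh_add, Real.cosh_sub]
    ring
  rw [hprod]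
  refine hasSum_le (fun n => ?_) ((Real.hasSum_cosh _).add (Real.hasSum_cosh _))
    ((Real.hasSum_cosh _).add (Real.hasSum_cosh _))
  rw [← add_div, ← add_div]
  refine div_le_div_of_nonneg_right ?_ (by positivity)
  simp only [pow_mul]
  refine pow_add_pow_le_of_mem_Icc (sq_nonneg _) ?_ ?_ ?_ n
  · have h1 := abs_norm_sub_norm_le u (-x)
    rw [norm_neg, sub_neg_eq_add] at h1
    exact sq_le_sq.2 (by rwa [abs_of_nonneg (norm_nonneg (u + x))])
  · exact pow_le_pow_left₀ (norm_nonneg _) (norm_add_le _ _) 2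
  · have := parallelogram_law_with_norm ℝ u x
    nlinarith

theorem expect_cosh_norm_sum_le {ι E : Type*} [Fintype ι] [DecidableEq ι] [NormedAddCommGroup E]
    [InnerProductSpace ℝ E] (y : ι → E) (s : Finset ι) :
    (Finset.univ.expect fun σ : ι → ℤˣ => Real.cosh ‖∑ i ∈ s, ((σ i : ℤ) : ℝ) • y i‖)
      ≤ ∏ i ∈ s, Real.cosh ‖y i‖ := by
  induction s using Finset.induction_on with
  | empty => simp
  | insert a s ha ih =>
    set S : (ι → ℤˣ) → E := fun σ => ∑ i ∈ s, ((σ i : ℤ) : ℝ) • y i with hS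
    -- flipping the sign of the new coordinate is an involution of the sign patterns
    let flip : (ι → ℤˣ) ≃ (ι → ℤˣ) := Function.Involutive.toPerm
      (fun σ => Function.update σ a (-σ a)) (fun σ => by simp)
    have hflip : ∀ σ, flip σ = Function.update σ a (-σ a) := fun _ => rfl
    have hflipS : ∀ σ, S (flip σ) = S σ := fun σ => by
      refine Finset.sum_congr rfl fun i hi => ?_
      have : i ≠ a := fun h => ha (h ▸ hi)
      simp [hflip, Function.update_of_ne this]
    have hins : ∀ σ, ∑ i ∈ insert a s, ((σ i : ℤ) : ℝ) • y i = ((σ a : ℤ) : ℝ) • y a + S σ :=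
      fun σ => Finset.sum_insert ha
    have hpair : ∀ σ : ι → ℤˣ,
        Real.cosh ‖((σ a : ℤ) : ℝ) • y a + S σ‖ + Real.cosh ‖-(((σ a : ℤ) : ℝ) • y a) + S σ‖
          ≤ 2 * Real.cosh ‖S σ‖ * Real.cosh ‖y a‖ := fun σ => by
      have h1 := cosh_norm_add_add_cosh_norm_sub_le (S σ) (((σ a : ℤ) : ℝ) • y a)
      have h2 : ‖((σ a : ℤ) : ℝ) • y a‖ = ‖y a‖ := by
        rcases Int.units_eq_one_or (σ a) with h | h <;> simp [h]
      rwa [h2, add_comm (S σ), sub_eq_neg_add] at h1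
    have hsymm : (Finset.univ.expect fun σ : ι → ℤˣ =>
          Real.cosh ‖((σ a : ℤ) : ℝ) • y a + S σ‖)
        = Finset.univ.expect fun σ : ι → ℤˣ => Real.cosh ‖-(((σ a : ℤ) : ℝ) • y a) + S σ‖ := by
      refine Fintype.expect_equiv flip _ _ fun σ => ?_
      rw [hflipS]
      simp [hflip]
    have hsum := Finset.expect_le_expect (s := Finset.univ) fun σ _ => hpair σ
    rw [Finset.expect_add_distrib, ← hsymm, ← Finset.expect_mul, ← Finset.mul_expect] at hsum
    simp_rw [hins]
    rw [Finset.prod_insert ha]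
    have hpos := Real.cosh_pos ‖y a‖
    nlinarith

/-- Rademacher sums in inner product spaces are sub-Gaussian, with the scalar constant. -/
theorem expect_exp_norm_signedSum_le {ι E : Type*} [Fintype ι] [DecidableEq ι]
    [NormedAddCommGroup E] [InnerProductSpace ℝ E] (y : ι → E) {lam v : ℝ} (hlam : 0 ≤ lam)
    (hv : ∑ i, ‖y i‖ ^ 2 ≤ v) :
    (Finset.univ.expect fun σ : ι → ℤˣ => Real.exp (lam * ‖signedSum σ y‖))
      ≤ 2 * Real.exp (lam ^ 2 * v / 2) := by
  have hle : ∀ σ : ι → ℤˣ, Real.exp (lam * ‖signedSum σ y‖)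
      ≤ 2 * Real.cosh ‖∑ i, ((σ i : ℤ) : ℝ) • (lam • y i)‖ := fun σ => by
    have : ∑ i, ((σ i : ℤ) : ℝ) • (lam • y i) = lam • signedSum σ y := by
      rw [signedSum, Finset.smul_sum]
      exact Finset.sum_congr rfl fun i _ => smul_comm _ _ _
    rw [this, norm_smul, Real.norm_of_nonneg hlam, Real.cosh_eq]
    linarith [Real.exp_pos (-(lam * ‖signedSum σ y‖))]
  refine (Finset.expect_le_expect fun σ _ => hle σ).trans ?_
  rw [← Finset.mul_expect]
  refine mul_le_mul_of_nonneg_left ((expect_cosh_norm_sum_le _ Finset.univ).trans ?_) (by norm_num)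
  calc ∏ i, Real.cosh ‖lam • y i‖ ≤ ∏ i, Real.exp (‖lam • y i‖ ^ 2 / 2) :=
        Finset.prod_le_prod (fun i _ => (Real.cosh_pos _).le)
          fun i _ => Real.cosh_le_exp_half_sq _
    _ = Real.exp (lam ^ 2 * (∑ i, ‖y i‖ ^ 2) / 2) := by
        rw [← Real.exp_sum]
        congr 1
        rw [Finset.mul_sum, Finset.sum_div]
        exact Finset.sum_congr rfl fun i _ => by
          rw [norm_smul, Real.norm_of_nonneg hlam]; ring
    _ ≤ _ := Real.exp_le_exp.2 (by nlinarith [sq_nonneg lam])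

/-- Maximal inequality for finitely many Rademacher sums. The majorant is
`lam⁻¹ * (log a + ∑ exp (lam * ·) / a - 1)`, which dominates the maximum because
`y ≤ log a + exp y / a - 1`; the best `a` is the bound on the expected sum of exponentials. -/
theorem exists_majorant_of_card_le {ι κ E : Type*} [Fintype ι] [DecidableEq ι]
    [NormedAddCommGroup E] [InnerProductSpace ℝ E] (K : Finset κ) (y : κ → ι → E) {lam v m : ℝ}
    (hlam : 0 < lam) (hm : 1 ≤ m) (hK : (K.card : ℝ) ≤ m)
    (hv : ∀ p ∈ K, ∑ i, ‖y p i‖ ^ 2 ≤ v) :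
    ∃ M : (ι → ℤˣ) → ℝ, (∀ σ, ∀ p ∈ K, ‖signedSum σ (y p)‖ ≤ M σ) ∧
      Finset.univ.expect M ≤ Real.log (2 * m) / lam + lam * v / 2 := by
  set B := 2 * Real.exp (lam ^ 2 * v / 2) with hB
  have hB0 : 0 < B := by positivity
  set a := m * B with ha
  have ha0 : 0 < a := by positivity
  refine ⟨fun σ => lam⁻¹ * (Real.log a + (∑ p ∈ K, Real.exp (lam * ‖signedSum σ (y p)‖)) / a - 1),
    fun σ p hp => ?_, ?_⟩
  · have h1 : Real.exp (lam * ‖signedSum σ (y p)‖)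
        ≤ ∑ p ∈ K, Real.exp (lam * ‖signedSum σ (y p)‖) :=
      Finset.single_le_sum (f := fun p => Real.exp (lam * ‖signedSum σ (y p)‖))
        (fun p _ => (Real.exp_pos _).le) hp
    have h2 := Real.add_one_le_exp (lam * ‖signedSum σ (y p)‖ - Real.log a)
    rw [Real.exp_sub, Real.exp_log ha0] at h2
    have h3 := div_le_div_of_nonneg_right h1 ha0.le
    rw [le_inv_mul_iff₀ hlam]
    linarith
  · have h1 : (Finset.univ.expect fun σ : ι → ℤˣ =>
        ∑ p ∈ K, Real.exp (lam * ‖signedSum σ (y p)‖)) ≤ a := by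
      rw [Finset.expect_sum_comm]
      calc _ ≤ ∑ p ∈ K, B := Finset.sum_le_sum fun p hp =>
            expect_exp_norm_signedSum_le (y p) hlam.le (hv p hp)
        _ = K.card * B := by rw [Finset.sum_const, nsmul_eq_mul]
        _ ≤ a := mul_le_mul_of_nonneg_right hK hB0.le
    rw [← Finset.mul_expect, Finset.expect_sub_distrib, Finset.expect_add_distrib,
      ← Finset.expect_div, Fintype.expect_const, Fintype.expect_const]
    have h2 := (div_le_one ha0).2 h1
    have h3 : Real.log a = Real.log (2 * m) + lam ^ 2 * v / 2 := by
      rw [ha, hB, show m * (2 * Real.exp (lam ^ 2 * v / 2))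
        = 2 * m * Real.exp (lam ^ 2 * v / 2) by ring, Real.log_mul (by positivity)
        (Real.exp_pos _).ne', Real.log_exp]
    rw [inv_mul_le_iff₀ hlam, h3]
    have h4 : lam * (Real.log (2 * m) / lam + lam * v / 2)
        = Real.log (2 * m) + lam ^ 2 * v / 2 := by
      field_simp
    linarith

/-! ### Chaining over a family of bounded VC dimension -/

/-- The vectors `x i` with `i ∈ J`, extended by zero to all indices. -/
noncomputable def restr {ι E : Type*} [Zero E] (x : ι → E) (J : Finset ι) : ι → E :=
  (J : Set ι).indicator x

theorem signedSum_sub {ι E : Type*} [Fintype ι] [AddCommGroup E] [Module ℝ E] (σ : ι → ℤˣ)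
    (y z : ι → E) : signedSum σ (y - z) = signedSum σ y - signedSum σ z := by
  simp [signedSum, smul_sub, Finset.sum_sub_distrib]

theorem signedSum_add {ι E : Type*} [Fintype ι] [AddCommGroup E] [Module ℝ E] (σ : ι → ℤˣ)
    (y z : ι → E) : signedSum σ (y + z) = signedSum σ y + signedSum σ z := by
  simp [signedSum, smul_add, Finset.sum_add_distrib]

theorem norm_signedSum_le {ι E : Type*} [Fintype ι] [NormedAddCommGroup E] [NormedSpace ℝ E]
    (σ : ι → ℤˣ) (y : ι → E) : ‖signedSum σ y‖ ≤ ∑ i, ‖y i‖ := by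
  refine (norm_sum_le _ _).trans (Finset.sum_le_sum fun i _ => le_of_eq ?_)
  rcases Int.units_eq_one_or (σ i) with h | h <;> simp [h]

theorem norm_restr_sub_restr {ι E : Type*} [DecidableEq ι] [NormedAddCommGroup E] (x : ι → E)
    (J J' : Finset ι) (i : ι) :
    ‖(restr x J - restr x J') i‖ = if i ∈ symmDiff J J' then ‖x i‖ else 0 := by
  by_cases h : i ∈ J <;> by_cases h' : i ∈ J' <;>
    simp [restr, h, h', Finset.mem_symmDiff]

theorem sum_sq_norm_restr_sub_le {ι E : Type*} [Fintype ι] [DecidableEq ι] [NormedAddCommGroup E]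
    {x : ι → E} {w : ι → ℝ} (hx : ∀ i, ‖x i‖ ^ 2 ≤ w i) (J J' : Finset ι) :
    ∑ i, ‖(restr x J - restr x J') i‖ ^ 2 ≤ ∑ i ∈ symmDiff J J', w i := by
  rw [← Finset.univ_inter (symmDiff J J'), ← Finset.sum_ite_mem]
  refine Finset.sum_le_sum fun i _ => ?_
  rw [norm_restr_sub_restr]
  split_ifs
  · exact hx i
  · simp

theorem sum_symmDiff_le {ι : Type*} [DecidableEq ι] {w : ι → ℝ} (hw : ∀ i, 0 ≤ w i)
    (A B C : Finset ι) :
    ∑ i ∈ symmDiff A C, w i ≤ ∑ i ∈ symmDiff A B, w i + ∑ i ∈ symmDiff B C, w i := by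
  rw [← Finset.sum_union_inter]
  refine (Finset.sum_le_sum_of_subset_of_nonneg (symmDiff_triangle A B C)
    fun i _ _ => hw i).trans (le_add_of_nonneg_right (Finset.sum_nonneg fun i _ => hw i))

/-- The contribution, relative to `√(∑ i, w i)`, of the links between the scales
`2⁻¹ ^ i` and `2⁻¹ ^ (i + 1)`. -/
noncomputable def linkBound (k i : ℕ) : ℝ :=
  (2 * entropyConst k + 2) * (i + 2) * √((2⁻¹ : ℝ) ^ i)

/-- The modulus of continuity of Rademacher sums over families of VC dimension at most `k`. -/
noncomputable def chainingModulus (k i : ℕ) : ℝ := 4 * ∑' j, linkBound k (j + i)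

theorem linkBound_nonneg (k i : ℕ) : 0 ≤ linkBound k i := by
  have := entropyConst_pos k
  unfold linkBound
  positivity

theorem summable_linkBound (k : ℕ) : Summable (linkBound k) := by
  have hr : ‖√(2⁻¹ : ℝ)‖ < 1 := by
    rw [Real.norm_of_nonneg (Real.sqrt_nonneg _), Real.sqrt_lt' one_pos]
    norm_num
  have h1 := summable_pow_mul_geometric_of_norm_lt_one 1 hr
  have h0 := summable_pow_mul_geometric_of_norm_lt_one 0 hr
  refine ((h1.add (h0.mul_left 2)).mul_left (2 * entropyConst k + 2)).congr fun i => ?_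
  have : √((2⁻¹ : ℝ) ^ i) = √(2⁻¹ : ℝ) ^ i := by
    rw [Real.sqrt_eq_iff_mul_self_eq (by positivity) (by positivity), ← mul_pow,
      Real.mul_self_sqrt (by norm_num)]
  rw [linkBound, this]
  ring

theorem chainingModulus_nonneg (k i : ℕ) : 0 ≤ chainingModulus k i :=
  mul_nonneg (by norm_num) (tsum_nonneg fun _ => linkBound_nonneg _ _)

theorem tendsto_chainingModulus (k : ℕ) : Tendsto (chainingModulus k) atTop (𝓝 0) := by
  have := (tendsto_sum_nat_add (linkBound k)).const_mul 4
  rwa [mul_zero] at this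

/-- The maximal inequality on a finite set of pairs of nets at scale `2⁻¹ ^ i`. The parameter
`lam` of the sub-Gaussian bound is the inverse of the typical size of a link. -/
theorem exists_majorant_link {ι E : Type*} [Fintype ι] [DecidableEq ι] [NormedAddCommGroup E]
    [InnerProductSpace ℝ E] (k i : ℕ) {N N' : Finset (Finset ι)} {x : ι → E} {w : ι → ℝ}
    (hx : ∀ i, ‖x i‖ ^ 2 ≤ w i) {W : ℝ} (hW : 0 < W)
    (hN : (N.card : ℝ) ≤ Real.exp (entropyConst k * (i + 2)))
    (hN' : (N'.card : ℝ) ≤ Real.exp (entropyConst k * (i + 2))) :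
    ∃ M : (ι → ℤˣ) → ℝ, (∀ σ, ∀ J ∈ N, ∀ J' ∈ N',
      ∑ a ∈ symmDiff J J', w a ≤ 3 * ((2⁻¹ : ℝ) ^ i * W) →
        ‖signedSum σ (restr x J) - signedSum σ (restr x J')‖ ≤ M σ) ∧
      Finset.univ.expect M ≤ linkBound k i * √W := by
  classical
  set r := √((2⁻¹ : ℝ) ^ i * W) with hr
  have hr0 : 0 < r := Real.sqrt_pos.2 (by positivity)
  have hr2 : r ^ 2 = (2⁻¹ : ℝ) ^ i * W := Real.sq_sqrt (by positivity)
  have hC := entropyConst_pos k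
  have hi : (0 : ℝ) ≤ i := Nat.cast_nonneg i
  obtain ⟨M, hM, hMle⟩ := exists_majorant_of_card_le
    (K := (N ×ˢ N').filter fun p => ∑ a ∈ symmDiff p.1 p.2, w a ≤ 3 * ((2⁻¹ : ℝ) ^ i * W))
    (y := fun p => restr x p.1 - restr x p.2) (lam := r⁻¹) (v := 3 * r ^ 2)
    (m := Real.exp (2 * (entropyConst k * (i + 2)))) (inv_pos.2 hr0)
    (Real.one_le_exp (by positivity))
    (by
      refine le_trans (Nat.cast_le.2 (Finset.card_filter_le _ _)) ?_
      rw [Finset.card_product, Nat.cast_mul, two_mul, Real.exp_add]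
      exact mul_le_mul hN hN' (Nat.cast_nonneg _) (Real.exp_pos _).le)
    (fun p hp => (sum_sq_norm_restr_sub_le hx _ _).trans (by
      rw [hr2]; exact (Finset.mem_filter.1 hp).2))
  refine ⟨M, fun σ J hJ J' hJ' hd => ?_, hMle.trans ?_⟩
  · rw [← signedSum_sub]
    exact hM σ (J, J') (Finset.mem_filter.2 ⟨Finset.mk_mem_product hJ hJ', hd⟩)
  · rw [Real.log_mul (by norm_num) (Real.exp_pos _).ne', Real.log_exp, div_inv_eq_mul,
      linkBound, mul_assoc, ← Real.sqrt_mul (by positivity), ← hr]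
    have h1 : r⁻¹ * (3 * r ^ 2) / 2 = 3 / 2 * r := by field_simp
    rw [h1, ← add_mul]
    refine mul_le_mul_of_nonneg_right ?_ hr0.le
    have := Real.log_two_lt_d9
    nlinarith

/-- The modulus of continuity, in the weighted distance `∑ i ∈ J ∆ J', w i` with
`‖x i‖ ^ 2 ≤ w i`, of the Rademacher sums indexed by a family of bounded VC dimension. Any two
members are joined through their approximations in the nets at the scales
`2⁻¹ ^ i₀, …, 2⁻¹ ^ (i₀ + |ι|)`; at the last scale the
Cauchy–Schwarz inequality suffices, because `|ι| ≤ 2 ^ |ι|`. -/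
theorem exists_majorant_of_vcDim_le {ι E : Type*} [Fintype ι] [DecidableEq ι]
    [NormedAddCommGroup E] [InnerProductSpace ℝ E] {T : Finset (Finset ι)} {k : ℕ}
    (hT : T.vcDim ≤ k) {x : ι → E} {w : ι → ℝ} (hx : ∀ i, ‖x i‖ ^ 2 ≤ w i)
    (hW : 0 < ∑ i, w i) (i₀ : ℕ) :
    ∃ M : (ι → ℤˣ) → ℝ, (∀ σ, ∀ J ∈ T, ∀ J' ∈ T,
      ∑ a ∈ symmDiff J J', w a ≤ (2⁻¹ : ℝ) ^ i₀ * ∑ a, w a →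
        ‖signedSum σ (restr x J) - signedSum σ (restr x J')‖ ≤ M σ) ∧
      Finset.univ.expect M ≤ chainingModulus k i₀ * √(∑ a, w a) := by
  have hw : ∀ i, 0 ≤ w i := fun i => (sq_nonneg _).trans (hx i)
  set W := ∑ a, w a with hWdef
  have hC := entropyConst_pos k
  choose N hNT hNcard hNnet using fun i => exists_net hT hw hW i
  have hπ : ∀ i, ∀ J, ∃ J', J ∈ T → J' ∈ N i ∧ ∑ a ∈ symmDiff J J', w a ≤ (2⁻¹ : ℝ) ^ i * W := by
    intro i J
    by_cases hJ : J ∈ T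
    · obtain ⟨J', h1, h2⟩ := hNnet i J hJ
      exact ⟨J', fun _ => ⟨h1, h2⟩⟩
    · exact ⟨∅, fun h => absurd h hJ⟩
  choose π hπ using hπ
  have hNcard' : ∀ i : ℕ, ((N i).card : ℝ) ≤ Real.exp (entropyConst k * (i + 2)) := fun i =>
    (hNcard i).trans (Real.exp_le_exp.2 (by nlinarith))
  choose M hM hMle using fun i : ℕ => exists_majorant_link k i hx hW (hNcard' i)
    (show ((N (i + 1)).card : ℝ) ≤ _ by
      refine (hNcard (i + 1)).trans (le_of_eq ?_)
      push_cast
      ring_nf)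
  obtain ⟨M₀, hM₀, hM₀le⟩ := exists_majorant_link k i₀ hx hW (hNcard' i₀) (hNcard' i₀)
  set S : (ι → ℤˣ) → Finset ι → E := fun σ J => signedSum σ (restr x J) with hS
  set q := Fintype.card ι with hq
  set e := √((2⁻¹ : ℝ) ^ i₀ * W) with he
  have hscale : ∀ i : ℕ, 0 < (2⁻¹ : ℝ) ^ i * W := fun i => by positivity
  have hchain : ∀ σ, ∀ J ∈ T, ∀ j,
      ‖S σ (π i₀ J) - S σ (π (i₀ + j) J)‖ ≤ ∑ l ∈ Finset.range j, M (l + i₀) σ := by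
    intro σ J hJ j
    induction j with
    | zero => simp
    | succ j ih =>
      rw [Finset.sum_range_succ]
      refine (norm_sub_le_norm_sub_add_norm_sub _ (S σ (π (i₀ + j) J)) _).trans (add_le_add ih ?_)
      rw [add_comm j i₀]
      refine hM (i₀ + j) σ _ (hπ _ J hJ).1 _ (hπ _ J hJ).1 ?_
      have h1 := (hπ (i₀ + j) J hJ).2
      have h2 := (hπ (i₀ + (j + 1)) J hJ).2
      rw [symmDiff_comm] at h1
      have h3 := sum_symmDiff_le hw (π (i₀ + j) J) J (π (i₀ + (j + 1)) J)
      have h4 := hscale (i₀ + j)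
      rw [← add_assoc, pow_succ] at h2
      rw [← add_assoc] at h3 ⊢
      linarith
  have hlast : ∀ σ, ∀ J ∈ T, ‖S σ J - S σ (π (i₀ + q) J)‖ ≤ e := by
    intro σ J hJ
    rw [hS, ← signedSum_sub]
    refine (norm_signedSum_le _ _).trans (Real.le_sqrt_of_sq_le ?_)
    refine (sq_sum_le_card_mul_sum_sq (s := Finset.univ)).trans ?_
    have h1 := (sum_sq_norm_restr_sub_le hx J (π (i₀ + q) J)).trans (hπ (i₀ + q) J hJ).2
    have h2 : (q : ℝ) * (2⁻¹ : ℝ) ^ q ≤ 1 := by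
      rw [inv_pow, mul_inv_le_iff₀ (by positivity), one_mul]
      exact_mod_cast (Nat.lt_two_pow_self (n := q)).le
    rw [Finset.card_univ, ← hq]
    have h3 : (q : ℝ) * ∑ i, ‖(restr x J - restr x (π (i₀ + q) J)) i‖ ^ 2
        ≤ q * ((2⁻¹ : ℝ) ^ (i₀ + q) * W) := mul_le_mul_of_nonneg_left h1 (Nat.cast_nonneg q)
    rw [pow_add] at h3
    have h4 := hscale i₀
    nlinarith
  have hjoin : ∀ σ, ∀ J ∈ T, ‖S σ J - S σ (π i₀ J)‖
      ≤ e + ∑ l ∈ Finset.range q, M (l + i₀) σ := by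
    intro σ J hJ
    refine (norm_sub_le_norm_sub_add_norm_sub _ (S σ (π (i₀ + q) J)) _).trans
      (add_le_add (hlast σ J hJ) ?_)
    rw [norm_sub_rev]
    exact hchain σ J hJ q
  refine ⟨fun σ => 2 * (e + ∑ l ∈ Finset.range q, M (l + i₀) σ) + M₀ σ,
    fun σ J hJ J' hJ' hd => ?_, ?_⟩
  · have h1 := hjoin σ J hJ
    have h2 := hjoin σ J' hJ'
    have h3 : ‖S σ (π i₀ J) - S σ (π i₀ J')‖ ≤ M₀ σ := by
      refine hM₀ σ _ (hπ _ J hJ).1 _ (hπ _ J' hJ').1 ?_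
      have h4 := (hπ i₀ J hJ).2
      have h5 := (hπ i₀ J' hJ').2
      have h6 := sum_symmDiff_le hw (π i₀ J) J (π i₀ J')
      have h7 := sum_symmDiff_le hw J J' (π i₀ J')
      rw [symmDiff_comm] at h4
      linarith
    have h4 := norm_sub_le_norm_sub_add_norm_sub (S σ J) (S σ (π i₀ J)) (S σ J')
    have h5 := norm_sub_le_norm_sub_add_norm_sub (S σ (π i₀ J)) (S σ (π i₀ J')) (S σ J')
    rw [norm_sub_rev] at h2
    linarith
  · rw [Finset.expect_add_distrib, ← Finset.mul_expect, Finset.expect_add_distrib,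
      Fintype.expect_const, Finset.expect_sum_comm]
    have hsum : ∑ l ∈ Finset.range q, (Finset.univ.expect fun σ => M (l + i₀) σ)
        ≤ (∑' j, linkBound k (j + i₀)) * √W := by
      refine (Finset.sum_le_sum fun l _ => hMle (l + i₀)).trans ?_
      rw [← Finset.sum_mul]
      exact mul_le_mul_of_nonneg_right
        (((summable_nat_add_iff i₀).2 (summable_linkBound k)).sum_le_tsum _
          fun j _ => linkBound_nonneg _ _) (Real.sqrt_nonneg _)
    have hfirst : linkBound k i₀ ≤ ∑' j, linkBound k (j + i₀) := by
      have := ((summable_nat_add_iff i₀).2 (summable_linkBound k)).le_tsum 0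
        fun j _ => linkBound_nonneg _ _
      simpa using this
    have hele : 2 * e ≤ linkBound k i₀ * √W := by
      rw [linkBound, mul_assoc, ← Real.sqrt_mul (by positivity), ← he]
      refine mul_le_mul_of_nonneg_right ?_ (Real.sqrt_nonneg _)
      have hi : (0 : ℝ) ≤ i₀ := Nat.cast_nonneg i₀
      nlinarith
    have hfirst' := mul_le_mul_of_nonneg_right hfirst (Real.sqrt_nonneg W)
    rw [chainingModulus]
    have : (Finset.univ.expect fun σ => M₀ σ) ≤ linkBound k i₀ * √W := hM₀le
    linarith

/-- Truncated form of the chaining bound: vectors with `‖x i‖ ^ 2 ≤ c` are chained with constant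
weights, so that the modulus refers to the counting distance, and the remaining vectors with the
weights `‖x i‖ ^ 2`. -/
theorem exists_majorant_truncated {ι E : Type*} [Fintype ι] [DecidableEq ι] [Nonempty ι]
    [NormedAddCommGroup E] [InnerProductSpace ℝ E] {T : Finset (Finset ι)} {k : ℕ}
    (hT : T.vcDim ≤ k) (x : ι → E) {c : ℝ} (hc : 0 < c) (i₀ : ℕ) :
    ∃ M : (ι → ℤˣ) → ℝ, (∀ σ, ∀ J ∈ T, ∀ J' ∈ T,
      ((symmDiff J J').card : ℝ) ≤ (2⁻¹ : ℝ) ^ i₀ * Fintype.card ι →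
        ‖signedSum σ (restr x J - restr x J')‖ ≤ M σ) ∧
      Finset.univ.expect M ≤ chainingModulus k i₀ * √(Fintype.card ι * c)
        + chainingModulus k 0 * √(∑ i, if c < ‖x i‖ ^ 2 then ‖x i‖ ^ 2 else 0) := by
  set x₁ : ι → E := fun i => if c < ‖x i‖ ^ 2 then 0 else x i with hx₁
  set x₂ : ι → E := fun i => if c < ‖x i‖ ^ 2 then x i else 0 with hx₂
  have hx : x = x₁ + x₂ := by
    ext i
    by_cases h : c < ‖x i‖ ^ 2 <;> simp [hx₁, hx₂, h]
  have hsq₂ : ∀ i, (if c < ‖x i‖ ^ 2 then ‖x i‖ ^ 2 else 0) = ‖x₂ i‖ ^ 2 := fun i => by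
    by_cases h : c < ‖x i‖ ^ 2 <;> simp [hx₂, h]
  simp_rw [hsq₂]
  have hrestr : ∀ J, restr x J = restr x₁ J + restr x₂ J := fun J => by
    rw [hx]; exact Set.indicator_add _ _ _
  have hsum : ∑ _i : ι, c = Fintype.card ι * c := by
    rw [Finset.sum_const, nsmul_eq_mul, Finset.card_univ]
  obtain ⟨M₁, hM₁, hM₁le⟩ := exists_majorant_of_vcDim_le hT (x := x₁) (w := fun _ => c)
    (fun i => by
      by_cases h : c < ‖x i‖ ^ 2
      · simp [hx₁, h, hc.le]
      · simpa only [hx₁, if_neg h] using not_lt.1 h)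
    (by rw [hsum]; positivity) i₀
  obtain ⟨M₂, hM₂, hM₂le⟩ : ∃ M : (ι → ℤˣ) → ℝ, (∀ σ, ∀ J ∈ T, ∀ J' ∈ T,
      ‖signedSum σ (restr x₂ J) - signedSum σ (restr x₂ J')‖ ≤ M σ) ∧
      Finset.univ.expect M ≤ chainingModulus k 0 * √(∑ i, ‖x₂ i‖ ^ 2) := by
    have hnn : ∀ i ∈ Finset.univ, 0 ≤ ‖x₂ i‖ ^ 2 := fun i _ => sq_nonneg _
    rcases (Finset.sum_nonneg hnn).eq_or_lt' with h0 | hpos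
    · rw [Finset.sum_eq_zero_iff_of_nonneg hnn] at h0
      have hx0 : x₂ = 0 := by
        ext i
        simpa using h0 i (Finset.mem_univ i)
      refine ⟨fun _ => 0, fun σ J _ J' _ => ?_, ?_⟩
      · simp [hx0, restr]
      · simp [hx0]
    · obtain ⟨M, hM, hMle⟩ := exists_majorant_of_vcDim_le hT (x := x₂) (fun i => le_rfl) hpos 0
      refine ⟨M, fun σ J hJ J' hJ' => hM σ J hJ J' hJ' ?_, hMle⟩
      rw [pow_zero, one_mul]
      exact Finset.sum_le_sum_of_subset_of_nonneg (Finset.subset_univ _) fun i hi _ => hnn i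
        (Finset.mem_univ i)
  refine ⟨fun σ => M₁ σ + M₂ σ, fun σ J hJ J' hJ' hd => ?_, ?_⟩
  · have h1 := hM₁ σ J hJ J' hJ' (by
      rw [Finset.sum_const, nsmul_eq_mul, hsum, ← mul_assoc]
      exact mul_le_mul_of_nonneg_right hd hc.le)
    have h2 := hM₂ σ J hJ J' hJ'
    rw [signedSum_sub, hrestr, hrestr, signedSum_add, signedSum_add, add_sub_add_comm]
    exact (norm_add_le _ _).trans (add_le_add h1 h2)
  · rw [Finset.expect_add_distrib, ← hsum]
    exact add_le_add hM₁le hM₂le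

/-! ### Symmetrization -/

/-- The first absolute moment is at most the root of the second, by
`|y| ≤ (2 * s)⁻¹ * y ^ 2 + s / 2`. -/
theorem lintegral_abs_le_of_lintegral_sq_le {Ω : Type*} [MeasurableSpace Ω] {P : Measure Ω}
    [IsProbabilityMeasure P] {f : Ω → ℝ} (hf : Measurable f) {s : ℝ} (hs : 0 < s)
    (h : ∫⁻ ω, ENNReal.ofReal (f ω ^ 2) ∂P ≤ ENNReal.ofReal (s ^ 2)) :
    ∫⁻ ω, ENNReal.ofReal |f ω| ∂P ≤ ENNReal.ofReal s := by
  have hpt : ∀ y : ℝ, |y| ≤ s / 2 + (2 * s)⁻¹ * y ^ 2 := fun y => by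
    have h2 : s / 2 + (2 * s)⁻¹ * y ^ 2 - |y| = (2 * s)⁻¹ * (|y| - s) ^ 2 := by
      rw [sub_sq, sq_abs]; field_simp; ring
    have h3 : 0 ≤ (2 * s)⁻¹ * (|y| - s) ^ 2 := by positivity
    linarith
  calc ∫⁻ ω, ENNReal.ofReal |f ω| ∂P
      ≤ ∫⁻ ω, (ENNReal.ofReal (s / 2)
        + ENNReal.ofReal (2 * s)⁻¹ * ENNReal.ofReal (f ω ^ 2)) ∂P := by
        refine lintegral_mono fun ω => ?_
        rw [← ENNReal.ofReal_mul (by positivity), ← ENNReal.ofReal_add (by positivity)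
          (by positivity)]
        exact ENNReal.ofReal_le_ofReal (hpt _)
    _ ≤ ENNReal.ofReal (s / 2) + ENNReal.ofReal (2 * s)⁻¹ * ENNReal.ofReal (s ^ 2) := by
        rw [lintegral_add_left measurable_const, lintegral_const, measure_univ, mul_one,
          lintegral_const_mul _ (hf.pow_const 2).ennreal_ofReal]
        gcongr
    _ = ENNReal.ofReal s := by
        rw [← ENNReal.ofReal_mul (by positivity), ← ENNReal.ofReal_add (by positivity)
          (by positivity)]
        congr 1
        field_simp
        ring

theorem lintegral_prodMk_of_indepFun {Ω α β : Type*} [MeasurableSpace Ω] [MeasurableSpace α]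
    [MeasurableSpace β] {P : Measure Ω} [IsProbabilityMeasure P] {Y : Ω → α} {Z : Ω → β}
    (hY : Measurable Y) (hZ : Measurable Z) (hYZ : IndepFun Y Z P) {f : α × β → ℝ≥0∞}
    (hf : Measurable f) :
    ∫⁻ ω, f (Y ω, Z ω) ∂P = ∫⁻ ω, ∫⁻ ω', f (Y ω, Z ω') ∂P ∂P := by
  rw [← lintegral_map hf (hY.prodMk hZ), hYZ.map_prod_eq_prod_map_map hY.aemeasurable
    hZ.aemeasurable, lintegral_prod _ hf.aemeasurable, lintegral_map hf.lintegral_prod_right' hY]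
  exact lintegral_congr fun ω => lintegral_map (hf.comp measurable_prodMk_left) hZ

/-- Jensen's inequality for the supremum of the norms: adding an independent centred vector does
not decrease the expectation. -/
theorem lintegral_iSup_enorm_le_of_indepFun {Ω κ E : Type*} [MeasurableSpace Ω] {P : Measure Ω}
    [IsProbabilityMeasure P] [Finite κ] [NormedAddCommGroup E] [NormedSpace ℝ E] [CompleteSpace E]
    [MeasurableSpace E] [BorelSpace E] [SecondCountableTopology E] {Y Z : Ω → κ → E}
    (hY : Measurable Y) (hZ : Measurable Z) (hYZ : IndepFun Y Z P)
    (hZint : ∀ p, Integrable (fun ω => Z ω p) P) (hZ0 : ∀ p, ∫ ω, Z ω p ∂P = 0) :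
    ∫⁻ ω, ⨆ p, ‖Y ω p‖ₑ ∂P ≤ ∫⁻ ω, ⨆ p, ‖Y ω p - Z ω p‖ₑ ∂P := by
  have hF : Measurable fun q : (κ → E) × (κ → E) => ⨆ p, ‖q.1 p - q.2 p‖ₑ := by
    refine .iSup fun p => ?_
    fun_prop
  have h1 : ∫⁻ ω, ⨆ p, ‖Y ω p - Z ω p‖ₑ ∂P
      = ∫⁻ ω, ∫⁻ ω', ⨆ p, ‖Y ω p - Z ω' p‖ₑ ∂P ∂P := by
    exact lintegral_prodMk_of_indepFun hY hZ hYZ hF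
  rw [h1]
  refine lintegral_mono fun ω => iSup_le fun p => ?_
  calc ‖Y ω p‖ₑ = ‖∫ ω', (Y ω p - Z ω' p) ∂P‖ₑ := by
        rw [integral_sub (integrable_const _) (hZint p), hZ0, sub_zero, integral_const]
        simp
    _ ≤ ∫⁻ ω', ‖Y ω p - Z ω' p‖ₑ ∂P := enorm_integral_le_lintegral_enorm _
    _ ≤ _ := lintegral_mono fun ω' => le_iSup (fun p => ‖Y ω p - Z ω' p‖ₑ) p

/-- Symmetrization with any fixed pattern of signs: the partial sums over the positive and over
the negative indices are independent and centred, so each is dominated by their difference. -/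
theorem lintegral_iSup_enorm_sum_le {Ω ι κ E : Type*} [MeasurableSpace Ω] {P : Measure Ω}
    [IsProbabilityMeasure P] [Fintype ι] [Finite κ] [NormedAddCommGroup E] [NormedSpace ℝ E]
    [CompleteSpace E] [MeasurableSpace E] [BorelSpace E] [SecondCountableTopology E]
    {X : ι → Ω → E} (hX : ∀ i, Measurable (X i)) (hind : iIndepFun X P)
    (hint : ∀ i, Integrable (X i) P) (h0 : ∀ i, ∫ ω, X i ω ∂P = 0) (a : κ → ι → ℝ)
    (σ : ι → ℤˣ) :
    ∫⁻ ω, ⨆ p, ‖∑ i, a p i • X i ω‖ₑ ∂P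
      ≤ 2 * ∫⁻ ω, ⨆ p, ‖signedSum σ (fun i => a p i • X i ω)‖ₑ ∂P := by
  classical
  let V : Finset ι → Ω → κ → E := fun I ω p => ∑ i ∈ I, a p i • X i ω
  have hV : ∀ I, Measurable (V I) := fun I => by
    refine measurable_pi_lambda _ fun p => ?_
    fun_prop
  have hVint : ∀ I p, Integrable (fun ω => V I ω p) P := fun I p =>
    integrable_finsetSum _ fun i _ => (hint i).smul (a p i)
  have hV0 : ∀ I p, ∫ ω, V I ω p ∂P = 0 := fun I p => by
    refine (integral_finsetSum I fun i _ => (hint i).smul (a p i)).trans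
      (Finset.sum_eq_zero fun i _ => ?_)
    exact (integral_smul _ _).trans (by rw [h0, smul_zero])
  have hVind : ∀ I I', Disjoint I I' → IndepFun (V I) (V I') P := fun I I' hII' => by
    have hm : ∀ I : Finset ι, Measurable fun (x : I → E) (p : κ) => ∑ i : I, a p i • x i :=
      fun I => by
        refine measurable_pi_lambda _ fun p => ?_
        fun_prop
    have heq : ∀ I, V I = (fun (x : I → E) (p : κ) => ∑ i : I, a p i • x i)
        ∘ fun ω (i : I) => X i ω := fun I => by
      ext ω p
      exact (Finset.sum_coe_sort I fun i => a p i • X i ω).symm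
    rw [heq I, heq I']
    exact (hind.indepFun_finset I I' hII' hX).comp (hm I) (hm I')
  set I := Finset.univ.filter fun i => σ i = 1 with hI
  set I' := Finset.univ.filter fun i => ¬ σ i = 1 with hI'
  have hdisj : Disjoint I I' := Finset.disjoint_filter_filter_not _ _ _
  have hsum : ∀ ω p, ∑ i, a p i • X i ω = V I ω p + V I' ω p := fun ω p =>
    (Finset.sum_filter_add_sum_filter_not _ _ _).symm
  have hsign : ∀ ω p, signedSum σ (fun i => a p i • X i ω) = V I ω p - V I' ω p := fun ω p => by
    rw [signedSum, ← Finset.sum_filter_add_sum_filter_not _ (fun i => σ i = 1), sub_eq_add_neg]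
    congr 1
    · exact Finset.sum_congr rfl fun i hi => by simp [(Finset.mem_filter.1 hi).2]
    · rw [← Finset.sum_neg_distrib]
      refine Finset.sum_congr rfl fun i hi => ?_
      have := (Int.units_eq_one_or (σ i)).resolve_left (Finset.mem_filter.1 hi).2
      simp [this]
  have h1 := lintegral_iSup_enorm_le_of_indepFun (hV I) (hV I') (hVind I I' hdisj) (hVint I')
    (hV0 I')
  have h2 := lintegral_iSup_enorm_le_of_indepFun (hV I') (hV I) (hVind I' I hdisj.symm) (hVint I)
    (hV0 I)
  simp_rw [hsum, hsign]
  calc ∫⁻ ω, ⨆ p, ‖V I ω p + V I' ω p‖ₑ ∂P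
      ≤ ∫⁻ ω, ((⨆ p, ‖V I ω p‖ₑ) + ⨆ p, ‖V I' ω p‖ₑ) ∂P :=
        lintegral_mono fun ω => iSup_le fun p => (enorm_add_le _ _).trans
          (add_le_add (le_iSup (fun p => ‖V I ω p‖ₑ) p) (le_iSup (fun p => ‖V I' ω p‖ₑ) p))
    _ = ∫⁻ ω, ⨆ p, ‖V I ω p‖ₑ ∂P + ∫⁻ ω, ⨆ p, ‖V I' ω p‖ₑ ∂P :=
        lintegral_add_left (.iSup fun p => ((measurable_pi_apply p).comp (hV I)).enorm) _
    _ ≤ _ := by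
        rw [two_mul]
        refine add_le_add h1 (h2.trans (le_of_eq ?_))
        exact lintegral_congr fun ω => iSup_congr fun p => by rw [← enorm_neg, neg_sub]

/-- Symmetrization followed by a pathwise bound on the average over all signs. -/
theorem lintegral_iSup_enorm_sum_le_of_majorant {Ω ι κ E : Type*} [MeasurableSpace Ω]
    {P : Measure Ω} [IsProbabilityMeasure P] [Fintype ι] [DecidableEq ι] [Finite κ]
    [NormedAddCommGroup E]
    [NormedSpace ℝ E] [CompleteSpace E] [MeasurableSpace E] [BorelSpace E]
    [SecondCountableTopology E] {X : ι → Ω → E} (hX : ∀ i, Measurable (X i))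
    (hind : iIndepFun X P) (hint : ∀ i, Integrable (X i) P) (h0 : ∀ i, ∫ ω, X i ω ∂P = 0)
    (a : κ → ι → ℝ) {B : Ω → ℝ}
    (hB : ∀ ω, ∃ M : (ι → ℤˣ) → ℝ, (∀ σ p, ‖signedSum σ (fun i => a p i • X i ω)‖ ≤ M σ) ∧
      Finset.univ.expect M ≤ B ω) :
    ∫⁻ ω, ⨆ p, ‖∑ i, a p i • X i ω‖ₑ ∂P ≤ 2 * ∫⁻ ω, ENNReal.ofReal (B ω) ∂P := by
  rcases isEmpty_or_nonempty κ with hκ | ⟨⟨p₀⟩⟩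
  · simp
  set c : ℕ := Fintype.card (ι → ℤˣ) with hc
  have hc0 : 0 < c := Fintype.card_pos
  have hmeas : ∀ σ : ι → ℤˣ,
      Measurable fun ω => ⨆ p, ‖signedSum σ (fun i => a p i • X i ω)‖ₑ := fun σ => by
    refine .iSup fun p => ?_
    unfold signedSum
    fun_prop
  have hpath : ∀ ω, ∑ σ : ι → ℤˣ, ⨆ p, ‖signedSum σ (fun i => a p i • X i ω)‖ₑ
      ≤ c * ENNReal.ofReal (B ω) := fun ω => by
    obtain ⟨M, hM, hMB⟩ := hB ω
    calc _ ≤ ∑ σ : ι → ℤˣ, ENNReal.ofReal (M σ) :=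
          Finset.sum_le_sum fun σ _ => iSup_le fun p => by
            rw [← ofReal_norm]; exact ENNReal.ofReal_le_ofReal (hM σ p)
      _ = ENNReal.ofReal (∑ σ : ι → ℤˣ, M σ) :=
          (ENNReal.ofReal_sum_of_nonneg fun σ _ => (norm_nonneg _).trans (hM σ p₀)).symm
      _ ≤ ENNReal.ofReal (c * B ω) := by
          refine ENNReal.ofReal_le_ofReal ?_
          rw [Fintype.expect_eq_sum_div_card, ← hc, div_le_iff₀' (by exact_mod_cast hc0)] at hMB
          exact hMB
      _ = _ := by rw [ENNReal.ofReal_mul (Nat.cast_nonneg _), ENNReal.ofReal_natCast]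
  have hmul : (c : ℝ≥0∞) * ∫⁻ ω, ⨆ p, ‖∑ i, a p i • X i ω‖ₑ ∂P
      ≤ c * (2 * ∫⁻ ω, ENNReal.ofReal (B ω) ∂P) := by
    calc _ = ∑ _σ : ι → ℤˣ, ∫⁻ ω, ⨆ p, ‖∑ i, a p i • X i ω‖ₑ ∂P := by
          rw [Finset.sum_const, nsmul_eq_mul, Finset.card_univ]
      _ ≤ ∑ σ : ι → ℤˣ, 2 * ∫⁻ ω, ⨆ p, ‖signedSum σ (fun i => a p i • X i ω)‖ₑ ∂P :=
          Finset.sum_le_sum fun σ _ => lintegral_iSup_enorm_sum_le hX hind hint h0 a σ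
      _ = 2 * ∫⁻ ω, ∑ σ : ι → ℤˣ, ⨆ p, ‖signedSum σ (fun i => a p i • X i ω)‖ₑ ∂P := by
          rw [← Finset.mul_sum, lintegral_finsetSum _ fun σ _ => hmeas σ]
      _ ≤ 2 * ∫⁻ ω, c * ENNReal.ofReal (B ω) ∂P := by
          gcongr with ω; exact hpath ω
      _ = _ := by
          rw [lintegral_const_mul' _ _ (ENNReal.natCast_ne_top _)]
          ring
  have hc' : (c : ℝ≥0∞) ≠ 0 := by exact_mod_cast hc0.ne'
  exact (ENNReal.mul_le_mul_iff_right hc' (ENNReal.natCast_ne_top c)).1 hmul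

/-- Asymptotic equicontinuity of the partial sums `∑ i ∈ J, X i` over a family of index sets of
bounded VC dimension, in the counting distance. -/
theorem lintegral_iSup_enorm_sub_le {Ω ι E : Type*} [MeasurableSpace Ω]
    {P : Measure Ω} [IsProbabilityMeasure P] [Fintype ι] [DecidableEq ι] [Nonempty ι]
    [NormedAddCommGroup E] [InnerProductSpace ℝ E] [CompleteSpace E] [MeasurableSpace E]
    [BorelSpace E] [SecondCountableTopology E] {X : ι → Ω → E} (hX : ∀ i, Measurable (X i))
    (hind : iIndepFun X P) (hint : ∀ i, Integrable (X i) P) (h0 : ∀ i, ∫ ω, X i ω ∂P = 0)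
    {c η : ℝ} (hc : 0 < c) (hη : 0 < η)
    (htail : ∀ i, ∫⁻ ω in {ω | c < ‖X i ω‖ ^ 2}, ENNReal.ofReal (‖X i ω‖ ^ 2) ∂P
      ≤ ENNReal.ofReal η)
    {T : Finset (Finset ι)} {k : ℕ} (hT : T.vcDim ≤ k) (i₀ : ℕ) :
    ∫⁻ ω, ⨆ p : {p : Finset ι × Finset ι // (p.1 ∈ T ∧ p.2 ∈ T) ∧
        ((symmDiff p.1 p.2).card : ℝ) ≤ (2⁻¹ : ℝ) ^ i₀ * Fintype.card ι},
        ‖∑ i ∈ p.1.1, X i ω - ∑ i ∈ p.1.2, X i ω‖ₑ ∂P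
      ≤ 2 * ENNReal.ofReal (√(Fintype.card ι)
        * (chainingModulus k i₀ * √c + chainingModulus k 0 * √η)) := by
  set n : ℝ := (Fintype.card ι : ℝ) with hn
  have hn0 : 0 < n := by rw [hn]; exact_mod_cast Fintype.card_pos
  set φ := chainingModulus k i₀ with hφ
  set φ₀ := chainingModulus k 0 with hφ₀
  have hφnn : 0 ≤ φ := chainingModulus_nonneg _ _
  have hφ₀nn : 0 ≤ φ₀ := chainingModulus_nonneg _ _
  set Y : Ω → ℝ := fun ω => ∑ i, if c < ‖X i ω‖ ^ 2 then ‖X i ω‖ ^ 2 else 0 with hYdef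
  have hYnn : ∀ ω, 0 ≤ Y ω := fun ω => Finset.sum_nonneg fun i _ => by split_ifs <;> positivity
  let a : {p : Finset ι × Finset ι // (p.1 ∈ T ∧ p.2 ∈ T) ∧
      ((symmDiff p.1 p.2).card : ℝ) ≤ (2⁻¹ : ℝ) ^ i₀ * Fintype.card ι} → ι → ℝ := fun p i =>
    (if i ∈ p.1.1 then 1 else 0) - if i ∈ p.1.2 then 1 else 0
  have ha : ∀ p ω, (fun i => a p i • X i ω)
      = restr (fun i => X i ω) p.1.1 - restr (fun i => X i ω) p.1.2 := fun p ω => by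
    ext i
    by_cases h : i ∈ p.1.1 <;> by_cases h' : i ∈ p.1.2 <;> simp [a, restr, h, h']
  have hasum : ∀ p ω, ∑ i, a p i • X i ω = ∑ i ∈ p.1.1, X i ω - ∑ i ∈ p.1.2, X i ω :=
    fun p ω => by
      have : ∀ i, a p i • X i ω = (if i ∈ p.1.1 then X i ω else 0)
          - if i ∈ p.1.2 then X i ω else 0 := fun i => by
        by_cases h : i ∈ p.1.1 <;> by_cases h' : i ∈ p.1.2 <;> simp [a, h, h']
      simp_rw [this, Finset.sum_sub_distrib, Finset.sum_ite_mem, Finset.univ_inter]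
  have hsym := lintegral_iSup_enorm_sum_le_of_majorant hX hind hint h0 a
    (B := fun ω => φ * √(n * c) + φ₀ * √(Y ω)) fun ω => by
      obtain ⟨M, hM, hMle⟩ := exists_majorant_truncated hT (fun i => X i ω) hc i₀
      refine ⟨M, fun σ p => ?_, hMle⟩
      rw [ha]
      exact hM σ _ p.2.1.1 _ p.2.1.2 p.2.2
  simp_rw [hasum] at hsym
  refine hsym.trans ?_
  gcongr
  set s := √(n * η) with hs
  have hs0 : 0 < s := Real.sqrt_pos.2 (by positivity)
  have hYmeas : Measurable Y := by
    refine Finset.measurable_sum _ fun i _ => Measurable.ite ?_ ?_ measurable_const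
    · exact measurableSet_lt measurable_const ((hX i).norm.pow_const 2)
    · exact (hX i).norm.pow_const 2
  have hYint : ∫⁻ ω, ENNReal.ofReal (Y ω) ∂P ≤ ENNReal.ofReal (n * η) := by
    have h1 : ∀ ω, ENNReal.ofReal (Y ω) = ∑ i, Set.indicator {ω | c < ‖X i ω‖ ^ 2}
        (fun ω => ENNReal.ofReal (‖X i ω‖ ^ 2)) ω := fun ω => by
      rw [hYdef, ENNReal.ofReal_sum_of_nonneg fun i _ => by split_ifs <;> positivity]
      refine Finset.sum_congr rfl fun i _ => ?_
      by_cases h : c < ‖X i ω‖ ^ 2 <;> simp [Set.indicator, h]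
    have hset : ∀ i, MeasurableSet {ω | c < ‖X i ω‖ ^ 2} := fun i =>
      measurableSet_lt measurable_const ((hX i).norm.pow_const 2)
    simp_rw [h1]
    rw [lintegral_finsetSum _ fun i _ =>
      ((hX i).norm.pow_const 2).ennreal_ofReal.indicator (hset i)]
    calc _ ≤ ∑ _i : ι, ENNReal.ofReal η := Finset.sum_le_sum fun i _ => by
          rw [lintegral_indicator (hset i)]; exact htail i
      _ = _ := by
          rw [Finset.sum_const, nsmul_eq_mul, Finset.card_univ, ENNReal.ofReal_mul hn0.le, hn,
            ENNReal.ofReal_natCast]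
  have hsqrt := lintegral_abs_le_of_lintegral_sq_le (P := P) hYmeas.sqrt hs0 (by
    simp_rw [Real.sq_sqrt (hYnn _)]
    rwa [hs, Real.sq_sqrt (by positivity)])
  simp_rw [abs_of_nonneg (Real.sqrt_nonneg _)] at hsqrt
  calc ∫⁻ ω, ENNReal.ofReal (φ * √(n * c) + φ₀ * √(Y ω)) ∂P
      = ENNReal.ofReal (φ * √(n * c))
        + ENNReal.ofReal φ₀ * ∫⁻ ω, ENNReal.ofReal √(Y ω) ∂P := by
        rw [← lintegral_const_mul _ hYmeas.sqrt.ennreal_ofReal]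
        simp_rw [ENNReal.ofReal_add (p := φ * √(n * c)) (by positivity)
          (mul_nonneg hφ₀nn (Real.sqrt_nonneg _)), ENNReal.ofReal_mul hφ₀nn]
        rw [lintegral_add_left measurable_const, lintegral_const, measure_univ, mul_one]
    _ ≤ ENNReal.ofReal (φ * √(n * c)) + ENNReal.ofReal φ₀ * ENNReal.ofReal s := by gcongr
    _ = _ := by
        rw [← ENNReal.ofReal_mul hφ₀nn, ← ENNReal.ofReal_add (by positivity) (by positivity), hs,
          Real.sqrt_mul hn0.le, Real.sqrt_mul hn0.le]
        ring_nf

/-! ### Concentration of the squared norm of a partial sum -/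

/-- Quantitative form of the conditions on a single increment: `τ` bounds the variances of the
components and `η` the truncation error of the squared norm at level `c`. -/
structure IsIncrement {Ω : Type*} [MeasurableSpace Ω] (P : Measure Ω) {d : ℕ} (τ c η : ℝ)
    (Z : Ω → EuclideanSpace ℝ (Fin d)) : Prop where
  measurable : Measurable Z
  centered : ∫ ω, Z ω ∂P = 0
  normalized : ∫ ω, ‖Z ω‖ ^ 2 ∂P = 1
  uncorrelated : ∀ a a', a ≠ a' → ∫ ω, Z ω a * Z ω a' ∂P = 0
  variance_le : ∀ a, ∫ ω, Z ω a ^ 2 ∂P ≤ τ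
  tail_le : ∫⁻ ω in {ω | c < ‖Z ω‖ ^ 2}, ENNReal.ofReal (‖Z ω‖ ^ 2) ∂P ≤ ENNReal.ofReal η

namespace IsIncrement

variable {Ω : Type*} [MeasurableSpace Ω] {P : Measure Ω} {d : ℕ} {τ c η : ℝ}
  {Z : Ω → EuclideanSpace ℝ (Fin d)}

theorem integrable_sq_norm (h : IsIncrement P τ c η Z) : Integrable (fun ω => ‖Z ω‖ ^ 2) P :=
  not_imp_comm.1 integral_undef (by rw [h.normalized]; exact one_ne_zero)

theorem memLp (h : IsIncrement P τ c η Z) : MemLp Z 2 P :=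
  (memLp_two_iff_integrable_sq_norm h.measurable.aestronglyMeasurable).2 h.integrable_sq_norm

theorem integrable [IsProbabilityMeasure P] (h : IsIncrement P τ c η Z) : Integrable Z P :=
  h.memLp.integrable one_le_two

theorem memLp_apply (h : IsIncrement P τ c η Z) (a : Fin d) : MemLp (fun ω => Z ω a) 2 P :=
  h.memLp.mono (by have := h.measurable; fun_prop)
    (ae_of_all _ fun ω => PiLp.norm_apply_le (Z ω) a)

theorem memLp_inner (h : IsIncrement P τ c η Z) (s : EuclideanSpace ℝ (Fin d)) :
    MemLp (fun ω => inner ℝ s (Z ω)) 2 P :=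
  h.memLp.const_inner s

theorem integral_inner_eq_zero [IsProbabilityMeasure P] (h : IsIncrement P τ c η Z)
    (s : EuclideanSpace ℝ (Fin d)) : ∫ ω, inner ℝ s (Z ω) ∂P = 0 := by
  rw [integral_inner h.integrable, h.centered, inner_zero_right]

theorem integral_inner_sq_le (h : IsIncrement P τ c η Z) (s : EuclideanSpace ℝ (Fin d)) :
    ∫ ω, inner ℝ s (Z ω) ^ 2 ∂P ≤ τ * ‖s‖ ^ 2 := by
  have hint : ∀ a b, Integrable (fun ω => s a * s b * (Z ω a * Z ω b)) P := fun a b =>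
    ((h.memLp_apply a).integrable_mul (h.memLp_apply b)).const_mul _
  have hexp : ∀ ω, inner ℝ s (Z ω) ^ 2 = ∑ a, ∑ b, s a * s b * (Z ω a * Z ω b) := fun ω => by
    rw [PiLp.inner_apply, sq, Finset.sum_mul_sum]
    refine Finset.sum_congr rfl fun a _ => Finset.sum_congr rfl fun b _ => ?_
    simp only [RCLike.inner_apply, conj_trivial]
    ring
  simp_rw [hexp]
  rw [integral_finsetSum _ fun a _ => integrable_finsetSum _ fun b _ => hint a b]
  simp_rw [integral_finsetSum Finset.univ fun b _ => hint _ b, integral_const_mul]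
  rw [EuclideanSpace.norm_sq_eq, Finset.mul_sum]
  refine Finset.sum_le_sum fun a _ => ?_
  rw [Finset.sum_eq_single a (fun b _ hb => by rw [h.uncorrelated a b hb.symm, mul_zero])
    (fun ha => absurd (Finset.mem_univ a) ha)]
  have := mul_le_mul_of_nonneg_left (h.variance_le a) (sq_nonneg (s a))
  simp_rw [sq] at this ⊢
  rw [Real.norm_eq_abs, abs_mul_abs_self]
  linarith

theorem lintegral_sq_norm_add [IsProbabilityMeasure P] (h : IsIncrement P τ c η Z)
    (s : EuclideanSpace ℝ (Fin d)) :
    ∫⁻ ω, ENNReal.ofReal (‖s + Z ω‖ ^ 2) ∂P = ENNReal.ofReal (‖s‖ ^ 2) + 1 := by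
  have hexp : ∀ ω, ‖s + Z ω‖ ^ 2 = ‖s‖ ^ 2 + 2 * inner ℝ s (Z ω) + ‖Z ω‖ ^ 2 := fun ω =>
    norm_add_sq_real _ _
  have hi1 : Integrable (fun ω => ‖s‖ ^ 2 + 2 * inner ℝ s (Z ω)) P :=
    (integrable_const _).add (((h.memLp_inner s).integrable one_le_two).const_mul 2)
  have hi : Integrable (fun ω => ‖s + Z ω‖ ^ 2) P := by
    simp_rw [hexp]; exact hi1.add h.integrable_sq_norm
  rw [← ofReal_integral_eq_lintegral_ofReal hi (ae_of_all _ fun ω => sq_nonneg _)]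
  simp_rw [hexp]
  rw [integral_add hi1 h.integrable_sq_norm, integral_add (integrable_const _)
    (((h.memLp_inner s).integrable one_le_two).const_mul 2), integral_const_mul,
    h.integral_inner_eq_zero, h.normalized, integral_const]
  simp [ENNReal.ofReal_add]

theorem lintegral_sq_add_inner_le [IsProbabilityMeasure P] (h : IsIncrement P τ c η Z) (hτ : 0 ≤ τ)
    (D : ℝ) (s : EuclideanSpace ℝ (Fin d)) :
    ∫⁻ ω, ENNReal.ofReal ((D + 2 * inner ℝ s (Z ω)) ^ 2) ∂P
      ≤ ENNReal.ofReal (D ^ 2) + ENNReal.ofReal (4 * τ) * ENNReal.ofReal (‖s‖ ^ 2) := by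
  have hexp : ∀ ω, (D + 2 * inner ℝ s (Z ω)) ^ 2
      = D ^ 2 + 4 * D * inner ℝ s (Z ω) + 4 * inner ℝ s (Z ω) ^ 2 := fun ω => by ring
  have hil := ((h.memLp_inner s).integrable one_le_two).const_mul (4 * D)
  have hiq := (h.memLp_inner s).integrable_sq.const_mul 4
  have hi1 : Integrable (fun ω => D ^ 2 + 4 * D * inner ℝ s (Z ω)) P :=
    (integrable_const _).add hil
  have hi : Integrable (fun ω => (D + 2 * inner ℝ s (Z ω)) ^ 2) P := by
    simp_rw [hexp]; exact hi1.add hiq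
  rw [← ofReal_integral_eq_lintegral_ofReal hi (ae_of_all _ fun ω => sq_nonneg _),
    ← ENNReal.ofReal_mul (by positivity), ← ENNReal.ofReal_add (by positivity) (by positivity)]
  refine ENNReal.ofReal_le_ofReal ?_
  simp_rw [hexp]
  rw [integral_add hi1 hiq, integral_add (integrable_const _) hil, integral_const_mul,
    integral_const_mul, h.integral_inner_eq_zero, integral_const]
  have := h.integral_inner_sq_le s
  simp only [probReal_univ, smul_eq_mul, one_mul, mul_zero, add_zero]
  linarith

end IsIncrement

section PartialSums

variable {Ω ι : Type*} [MeasurableSpace Ω] {P : Measure Ω} [IsProbabilityMeasure P]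
  {d : ℕ} {τ c η : ℝ} {X : ι → Ω → EuclideanSpace ℝ (Fin d)}

/-- The cross terms `∑ i ≠ j, ⟪X i, X j⟫` in the squared norm of a partial sum have small second
moment. Adding one increment `Z` to the partial sum `s` adds `2 * ⟪s, Z⟫` to the cross terms, with
conditional mean zero and conditional second moment at most `4 * τ * ‖s‖ ^ 2`. -/
theorem lintegral_sq_crossTerms_le (hX : ∀ i, IsIncrement P τ c η (X i)) (hind : iIndepFun X P)
    (hτ : 0 ≤ τ) (J : Finset ι) :
    ∫⁻ ω, ENNReal.ofReal (‖∑ i ∈ J, X i ω‖ ^ 2) ∂P ≤ J.card ∧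
    ∫⁻ ω, ENNReal.ofReal ((‖∑ i ∈ J, X i ω‖ ^ 2 - ∑ i ∈ J, ‖X i ω‖ ^ 2) ^ 2) ∂P
      ≤ ENNReal.ofReal (2 * τ) * (J.card : ℝ≥0∞) ^ 2 := by
  classical
  induction J using Finset.induction_on with
  | empty => simp
  | insert a J ha ih =>
    obtain ⟨ih1, ih2⟩ := ih
    set S : Ω → EuclideanSpace ℝ (Fin d) := fun ω => ∑ i ∈ J, X i ω with hS
    set D : Ω → ℝ := fun ω => ‖S ω‖ ^ 2 - ∑ i ∈ J, ‖X i ω‖ ^ 2 with hD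
    have hXm : ∀ i, Measurable (X i) := fun i => (hX i).measurable
    have hSm : Measurable S := by fun_prop
    have hDm : Measurable D := by fun_prop
    have hindep : IndepFun (fun ω => (D ω, S ω)) (X a) P := by
      have h1 := hind.indepFun_finset J {a} (Finset.disjoint_singleton_right.2 ha) hXm
      have h2 : Measurable fun x : J → EuclideanSpace ℝ (Fin d) =>
          (‖∑ i, x i‖ ^ 2 - ∑ i, ‖x i‖ ^ 2, ∑ i, x i) := by fun_prop
      have h3 : Measurable fun x : ({a} : Finset ι) → EuclideanSpace ℝ (Fin d) =>
          x ⟨a, Finset.mem_singleton_self a⟩ := measurable_pi_apply _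
      have h4 := h1.comp h2 h3
      have h5 : (fun ω => (D ω, S ω)) = (fun x : J → EuclideanSpace ℝ (Fin d) =>
          (‖∑ i, x i‖ ^ 2 - ∑ i, ‖x i‖ ^ 2, ∑ i, x i)) ∘ fun ω (i : J) => X i ω := by
        ext1 ω
        simp only [hD, hS, Function.comp_apply]
        rw [Finset.sum_coe_sort J fun i => X i ω, Finset.sum_coe_sort J fun i => ‖X i ω‖ ^ 2]
      rw [h5]
      exact h4
    rw [Finset.card_insert_of_notMem ha, Nat.cast_add, Nat.cast_one]
    have hsum : ∀ ω, ∑ i ∈ insert a J, X i ω = S ω + X a ω := fun ω => by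
      rw [Finset.sum_insert ha, add_comm]
    simp_rw [hsum]
    constructor
    · rw [lintegral_prodMk_of_indepFun (hDm.prodMk hSm) (hXm a) hindep
        (f := fun q => ENNReal.ofReal (‖q.1.2 + q.2‖ ^ 2)) (by fun_prop)]
      simp_rw [(hX a).lintegral_sq_norm_add]
      rw [lintegral_add_right _ measurable_const, lintegral_const, measure_univ, mul_one]
      gcongr
    · have hcross : ∀ ω, ‖S ω + X a ω‖ ^ 2 - ∑ i ∈ insert a J, ‖X i ω‖ ^ 2
          = D ω + 2 * inner ℝ (S ω) (X a ω) := fun ω => by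
        rw [Finset.sum_insert ha, norm_add_sq_real, hD]
        ring
      simp_rw [hcross]
      rw [lintegral_prodMk_of_indepFun (hDm.prodMk hSm) (hXm a) hindep
        (f := fun q => ENNReal.ofReal ((q.1.1 + 2 * inner ℝ q.1.2 q.2) ^ 2)) (by fun_prop)]
      refine (lintegral_mono fun ω => (hX a).lintegral_sq_add_inner_le hτ (D ω) (S ω)).trans ?_
      rw [lintegral_add_left (by fun_prop), lintegral_const_mul _ (by fun_prop)]
      calc _ ≤ ENNReal.ofReal (2 * τ) * (J.card : ℝ≥0∞) ^ 2
            + ENNReal.ofReal (4 * τ) * J.card := by gcongr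
        _ ≤ ENNReal.ofReal (2 * τ) * (J.card : ℝ≥0∞) ^ 2
            + ENNReal.ofReal (2 * τ) * (2 * J.card + 1) := by
            rw [show 4 * τ = 2 * τ * 2 by ring, ENNReal.ofReal_mul (p := 2 * τ) (by positivity),
              mul_assoc, ENNReal.ofReal_ofNat]
            gcongr
            exact le_self_add
        _ = _ := by ring

/-- A weak law of large numbers for the squared norms, by truncation at level `c`. -/
theorem lintegral_abs_sum_sq_norm_sub_le (hX : ∀ i, IsIncrement P τ c η (X i))
    (hind : iIndepFun X P) (hc : 0 < c) (hη : 0 ≤ η) (J : Finset ι) {n : ℕ} (hn : 0 < n)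
    (hJ : J.card ≤ n) :
    ∫⁻ ω, ENNReal.ofReal |∑ i ∈ J, (‖X i ω‖ ^ 2 - 1)| ∂P
      ≤ ENNReal.ofReal (c * √n + n * (2 * η)) := by
  have hXm : ∀ i, Measurable (X i) := fun i => (hX i).measurable
  set Y : ι → Ω → ℝ := fun i ω => min (‖X i ω‖ ^ 2) c with hY
  set R : ι → Ω → ℝ := fun i ω => ‖X i ω‖ ^ 2 - Y i ω with hR
  have hYm : ∀ i, Measurable (Y i) := fun i => by fun_prop
  have hRm : ∀ i, Measurable (R i) := fun i => by fun_prop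
  have hY0 : ∀ i ω, 0 ≤ Y i ω := fun i ω => le_min (sq_nonneg _) hc.le
  have hYc : ∀ i ω, Y i ω ≤ c := fun i ω => min_le_right _ _
  have hR0 : ∀ i ω, 0 ≤ R i ω := fun i ω => sub_nonneg.2 (min_le_left _ _)
  have hYLp : ∀ i, MemLp (Y i) 2 P := fun i =>
    MemLp.of_bound (hYm i).aestronglyMeasurable c (ae_of_all _ fun ω => by
      rw [Real.norm_of_nonneg (hY0 i ω)]; exact hYc i ω)
  have hYint : ∀ i, Integrable (Y i) P := fun i => (hYLp i).integrable one_le_two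
  have hRint : ∀ i, Integrable (R i) P := fun i => (hX i).integrable_sq_norm.sub (hYint i)
  have hRle : ∀ i, ∫⁻ ω, ENNReal.ofReal (R i ω) ∂P ≤ ENNReal.ofReal η := fun i => by
    refine le_trans ?_ (hX i).tail_le
    rw [← lintegral_indicator (measurableSet_lt measurable_const ((hXm i).norm.pow_const 2))]
    refine lintegral_mono fun ω => ?_
    by_cases h : c < ‖X i ω‖ ^ 2
    · rw [Set.indicator_of_mem (show ω ∈ {ω | c < ‖X i ω‖ ^ 2} from h)]
      exact ENNReal.ofReal_le_ofReal (sub_le_self _ (hY0 i ω))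
    · simp [hR, hY, min_eq_left (not_lt.1 h)]
  have hRintle : ∀ i, ∫ ω, R i ω ∂P ≤ η := fun i => by
    rw [← ENNReal.ofReal_le_ofReal_iff hη,
      ofReal_integral_eq_lintegral_ofReal (hRint i) (ae_of_all _ (hR0 i))]
    exact hRle i
  have hRint0 : ∀ i, 0 ≤ ∫ ω, R i ω ∂P := fun i => integral_nonneg (hR0 i)
  have hYR : ∀ i, ∫ ω, Y i ω ∂P = 1 - ∫ ω, R i ω ∂P := fun i => by
    have : ∫ ω, R i ω ∂P = ∫ ω, ‖X i ω‖ ^ 2 ∂P - ∫ ω, Y i ω ∂P :=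
      integral_sub (hX i).integrable_sq_norm (hYint i)
    rw [(hX i).normalized] at this
    linarith
  set V : Ω → ℝ := ∑ i ∈ J, Y i with hV
  have hVm : Measurable V := by
    rw [hV]; fun_prop
  have hVLp : MemLp V 2 P := memLp_finsetSum' J fun i _ => hYLp i
  have hVmean : ∫ ω, V ω ∂P = ∑ i ∈ J, ∫ ω, Y i ω ∂P := by
    rw [hV, ← integral_finsetSum J fun i _ => hYint i]
    simp
  have hn0 : (0 : ℝ) < n := by exact_mod_cast hn
  have hJn : (J.card : ℝ) ≤ n := by exact_mod_cast hJ
  have hvar : Var[V; P] ≤ n * c ^ 2 := by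
    rw [hV, IndepFun.variance_sum (fun i _ => hYLp i) fun i _ j _ hij =>
      (hind.indepFun hij).comp (φ := fun x => min (‖x‖ ^ 2) c) (ψ := fun x => min (‖x‖ ^ 2) c)
        (by fun_prop) (by fun_prop)]
    calc ∑ i ∈ J, Var[Y i; P] ≤ ∑ _i ∈ J, c ^ 2 := Finset.sum_le_sum fun i _ => by
          refine (variance_le_sq_of_bounded (a := 0) (b := c) (ae_of_all _ fun ω =>
            ⟨hY0 i ω, hYc i ω⟩) (hYm i).aemeasurable).trans ?_
          nlinarith [sq_nonneg c]
      _ = J.card * c ^ 2 := by rw [Finset.sum_const, nsmul_eq_mul]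
      _ ≤ _ := by gcongr
  have hcentral : ∫⁻ ω, ENNReal.ofReal |V ω - ∫ ω, V ω ∂P| ∂P ≤ ENNReal.ofReal (c * √n) := by
    refine lintegral_abs_le_of_lintegral_sq_le (hVm.sub_const _) (by positivity) ?_
    have hsq : Integrable (fun ω => (V ω - ∫ ω, V ω ∂P) ^ 2) P :=
      (hVLp.sub (memLp_const _)).integrable_sq
    rw [← ofReal_integral_eq_lintegral_ofReal hsq (ae_of_all _ fun ω => sq_nonneg _),
      ← variance_eq_integral hVm.aemeasurable]
    refine ENNReal.ofReal_le_ofReal (hvar.trans (le_of_eq ?_))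
    rw [mul_pow, Real.sq_sqrt hn0.le, mul_comm]
  have hpt : ∀ ω, ENNReal.ofReal |∑ i ∈ J, (‖X i ω‖ ^ 2 - 1)|
      ≤ ENNReal.ofReal |V ω - ∫ ω, V ω ∂P|
        + (∑ i ∈ J, ENNReal.ofReal (R i ω) + ENNReal.ofReal (n * η)) := fun ω => by
    have h1 : ∑ i ∈ J, (‖X i ω‖ ^ 2 - 1)
        = (V ω - ∫ ω, V ω ∂P) + (∑ i ∈ J, R i ω - ∑ i ∈ J, ∫ ω, R i ω ∂P) := by
      rw [hVmean, hV, Finset.sum_apply, ← Finset.sum_sub_distrib, ← Finset.sum_sub_distrib,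
        ← Finset.sum_add_distrib]
      refine Finset.sum_congr rfl fun i _ => ?_
      rw [hYR, hR]
      ring
    have h2 : 0 ≤ ∑ i ∈ J, ∫ ω, R i ω ∂P := Finset.sum_nonneg fun i _ => hRint0 i
    have h3 : ∑ i ∈ J, ∫ ω, R i ω ∂P ≤ n * η := by
      refine (Finset.sum_le_card_nsmul J _ η fun i _ => hRintle i).trans ?_
      rw [nsmul_eq_mul]
      gcongr
    have h4 : 0 ≤ ∑ i ∈ J, R i ω := Finset.sum_nonneg fun i _ => hR0 i ω
    rw [← ENNReal.ofReal_sum_of_nonneg fun i _ => hR0 i ω, ← ENNReal.ofReal_add h4 (by positivity),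
      ← ENNReal.ofReal_add (abs_nonneg _) (by positivity)]
    refine ENNReal.ofReal_le_ofReal ?_
    rw [h1]
    refine (abs_add_le _ _).trans (add_le_add le_rfl ?_)
    rw [abs_le]
    constructor <;> linarith
  calc _ ≤ _ := lintegral_mono hpt
    _ ≤ ENNReal.ofReal (c * √n) + (∑ _i ∈ J, ENNReal.ofReal η + ENNReal.ofReal (n * η)) := by
        rw [lintegral_add_left (by fun_prop), lintegral_add_right _ measurable_const,
          lintegral_finsetSum _ fun i _ => (hRm i).ennreal_ofReal, lintegral_const, measure_univ,
          mul_one]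
        gcongr with i
        exact hRle i
    _ ≤ _ := by
        rw [Finset.sum_const, nsmul_eq_mul, ← ENNReal.ofReal_natCast,
          ← ENNReal.ofReal_mul (Nat.cast_nonneg _), ← ENNReal.ofReal_add (by positivity)
          (by positivity), ← ENNReal.ofReal_add (by positivity) (by positivity)]
        refine ENNReal.ofReal_le_ofReal ?_
        have := mul_le_mul_of_nonneg_right hJn hη
        linarith

/-- The squared norm of a partial sum over `J` is close to `|J|`, uniformly in `J`. -/
theorem lintegral_abs_sq_norm_sum_sub_card_le (hX : ∀ i, IsIncrement P τ c η (X i))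
    (hind : iIndepFun X P) (hτ : 0 < τ) (hc : 0 < c) (hη : 0 ≤ η) (J : Finset ι) {n : ℕ}
    (hn : 0 < n) (hJ : J.card ≤ n) :
    ∫⁻ ω, ENNReal.ofReal |‖∑ i ∈ J, X i ω‖ ^ 2 - J.card| ∂P
      ≤ ENNReal.ofReal (n * (√(2 * τ) + 2 * η) + c * √n) := by
  have hXm : ∀ i, Measurable (X i) := fun i => (hX i).measurable
  have hn0 : (0 : ℝ) < n := by exact_mod_cast hn
  have h1 : ∫⁻ ω, ENNReal.ofReal |‖∑ i ∈ J, X i ω‖ ^ 2 - ∑ i ∈ J, ‖X i ω‖ ^ 2| ∂P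
      ≤ ENNReal.ofReal (n * √(2 * τ)) := by
    refine lintegral_abs_le_of_lintegral_sq_le (by fun_prop) (by positivity) ?_
    refine (lintegral_sq_crossTerms_le hX hind hτ.le J).2.trans ?_
    rw [mul_pow, Real.sq_sqrt (by positivity), mul_comm,
      ENNReal.ofReal_mul (p := (n : ℝ) ^ 2) (by positivity), ENNReal.ofReal_pow hn0.le,
      ENNReal.ofReal_natCast]
    gcongr
  have h2 := lintegral_abs_sum_sq_norm_sub_le hX hind hc hη J hn hJ
  calc _ ≤ ∫⁻ ω, (ENNReal.ofReal |‖∑ i ∈ J, X i ω‖ ^ 2 - ∑ i ∈ J, ‖X i ω‖ ^ 2|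
        + ENNReal.ofReal |∑ i ∈ J, (‖X i ω‖ ^ 2 - 1)|) ∂P := by
        refine lintegral_mono fun ω => ?_
        rw [← ENNReal.ofReal_add (abs_nonneg _) (abs_nonneg _)]
        refine ENNReal.ofReal_le_ofReal (le_trans (le_of_eq ?_) (abs_add_le _ _))
        rw [Finset.sum_sub_distrib, Finset.sum_const, nsmul_eq_mul, mul_one]
        congr 1
        ring
    _ ≤ ENNReal.ofReal (n * √(2 * τ)) + ENNReal.ofReal (c * √n + n * (2 * η)) := by
        rw [lintegral_add_left (by fun_prop)]
        exact add_le_add h1 h2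
    _ = _ := by
        rw [← ENNReal.ofReal_add (by positivity) (by positivity)]
        ring_nf

end PartialSums

/-! ### Partial sums over a deterministic family of index sets -/

theorem abs_sqrt_sub_sqrt_le {a b : ℝ} (ha : 0 ≤ a) (hb : 0 ≤ b) : |√a - √b| ≤ √|a - b| := by
  refine Real.le_sqrt_of_sq_le ?_
  have h1 := Real.sq_sqrt ha
  have h2 := Real.sq_sqrt hb
  have h3 := Real.sqrt_nonneg a
  have h4 := Real.sqrt_nonneg b
  have h5 : |a - b| = |√a - √b| * (√a + √b) := by
    rw [← abs_of_nonneg (add_nonneg h3 h4), ← abs_mul]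
    congr 1
    linear_combination h2 - h1
  rw [h5, sq]
  refine mul_le_mul_of_nonneg_left ?_ (abs_nonneg _)
  rw [abs_le]
  constructor <;> linarith

theorem abs_card_sub_card_le {ι : Type*} [DecidableEq ι] (J J' : Finset ι) :
    |(J.card : ℝ) - J'.card| ≤ (symmDiff J J').card := by
  have h : ∀ A B : Finset ι, (A.card : ℝ) ≤ B.card + (symmDiff A B).card := fun A B => by
    have h1 : A ⊆ B ∪ symmDiff A B := fun i hi => by
      rw [Finset.mem_union, Finset.mem_symmDiff]
      tauto
    exact_mod_cast (Finset.card_le_card h1).trans (Finset.card_union_le _ _)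
  have h1 := h J J'
  have h2 := h J' J
  rw [symmDiff_comm J' J] at h2
  rw [abs_le]
  constructor <;> linarith

/-- The deviation of the normalised norm of the partial sum of `x` over `J` from `√(|J| / n)`. -/
noncomputable def deviation {E : Type*} [NormedAddCommGroup E] {n : ℕ} (x : Fin n → E)
    (J : Finset (Fin n)) : ℝ :=
  |(√n)⁻¹ * ‖∑ i ∈ J, x i‖ - √(J.card / n)|

theorem deviation_lt_of_net {E : Type*} [NormedAddCommGroup E] {n i₀ : ℕ} {ε : ℝ}
    (hn : (0 : ℝ) < n) {x : Fin n → E} {J J' : Finset (Fin n)}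
    (hclose : ((symmDiff J J').card : ℝ) ≤ (2⁻¹ : ℝ) ^ i₀ * n) (hi₀ : √((2⁻¹ : ℝ) ^ i₀) ≤ ε)
    (h1 : (√n)⁻¹ * ‖∑ i ∈ J, x i - ∑ i ∈ J', x i‖ < ε) (h2 : deviation x J' < ε) :
    deviation x J < 3 * ε := by
  have hsn : 0 < (√n)⁻¹ := inv_pos.2 (Real.sqrt_pos.2 hn)
  have h3 : |√(J.card / n) - √(J'.card / n)| ≤ ε := by
    refine (abs_sqrt_sub_sqrt_le (by positivity) (by positivity)).trans
      ((Real.sqrt_le_sqrt ?_).trans hi₀)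
    rw [← sub_div, abs_div, abs_of_pos hn, div_le_iff₀ hn]
    exact (abs_card_sub_card_le _ _).trans hclose
  have h4 : |(√n)⁻¹ * ‖∑ i ∈ J, x i‖ - (√n)⁻¹ * ‖∑ i ∈ J', x i‖| < ε := by
    refine lt_of_le_of_lt ?_ h1
    rw [← mul_sub, abs_mul, abs_of_pos hsn]
    exact mul_le_mul_of_nonneg_left (abs_norm_sub_norm_le _ _) hsn.le
  unfold deviation at h2 ⊢
  rw [abs_lt] at h2 h4 ⊢
  rw [abs_le] at h3
  constructor <;> linarith

section Deviation

variable {Ω : Type*} [MeasurableSpace Ω] {P : Measure Ω} {d n : ℕ}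
  {X : Fin n → Ω → EuclideanSpace ℝ (Fin d)}

theorem measure_le_deviation_le (hX : ∀ i, Measurable (X i)) (hn : 0 < n) {κ ε : ℝ} (hε : 0 < ε)
    (J : Finset (Fin n))
    (hκ : ∫⁻ ω, ENNReal.ofReal |‖∑ i ∈ J, X i ω‖ ^ 2 - J.card| ∂P ≤ ENNReal.ofReal (n * κ)) :
    P {ω | ε ≤ deviation (fun i => X i ω) J} ≤ ENNReal.ofReal (κ / ε ^ 2) := by
  have hn0 : (0 : ℝ) < n := by exact_mod_cast hn
  have hsub : {ω | ε ≤ deviation (fun i => X i ω) J}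
      ⊆ {ω | ENNReal.ofReal (n * ε ^ 2) ≤ ENNReal.ofReal |‖∑ i ∈ J, X i ω‖ ^ 2 - J.card|} := by
    intro ω hω
    refine ENNReal.ofReal_le_ofReal ?_
    have h1 : (√n)⁻¹ * ‖∑ i ∈ J, X i ω‖ = √(‖∑ i ∈ J, X i ω‖ ^ 2 / n) := by
      rw [Real.sqrt_div (sq_nonneg _), Real.sqrt_sq (norm_nonneg _), inv_mul_eq_div]
    have h2 : ε ≤ √|‖∑ i ∈ J, X i ω‖ ^ 2 / n - J.card / n| := by
      refine le_trans ?_ (abs_sqrt_sub_sqrt_le (by positivity) (by positivity))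
      rw [← h1]
      exact hω
    rw [Real.le_sqrt hε.le (abs_nonneg _), ← sub_div, abs_div, abs_of_pos hn0,
      le_div_iff₀' hn0] at h2
    exact h2
  refine (measure_mono hsub).trans ((meas_ge_le_lintegral_div (by fun_prop) (by
    rw [Ne, ENNReal.ofReal_eq_zero, not_le]; positivity) ENNReal.ofReal_ne_top).trans ?_)
  refine (ENNReal.div_le_div_right hκ _).trans (le_of_eq ?_)
  rw [← ENNReal.ofReal_div_of_pos (by positivity)]
  congr 1
  field_simp

/-- The deviations over a family of bounded VC dimension are uniformly small: those over a net of
scale `2⁻¹ ^ i₀` because the net is finite, all others by equicontinuity. -/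
theorem measure_exists_le_deviation_le [IsProbabilityMeasure P] {τ c η κ ε : ℝ}
    (hX : ∀ i, IsIncrement P τ c η (X i))
    (hind : iIndepFun X P) (hc : 0 < c) (hη : 0 < η) (hn : 0 < n) (hε : 0 < ε)
    (hκ : ∀ J : Finset (Fin n),
      ∫⁻ ω, ENNReal.ofReal |‖∑ i ∈ J, X i ω‖ ^ 2 - J.card| ∂P ≤ ENNReal.ofReal (n * κ))
    {T : Finset (Finset (Fin n))} {k : ℕ} (hT : T.vcDim ≤ k) {i₀ : ℕ}
    (hi₀ : √((2⁻¹ : ℝ) ^ i₀) ≤ ε) :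
    P {ω | ∃ J ∈ T, 3 * ε ≤ deviation (fun i => X i ω) J}
      ≤ ENNReal.ofReal (2 * (chainingModulus k i₀ * √c + chainingModulus k 0 * √η) / ε)
        + ENNReal.ofReal (Real.exp (entropyConst k * (i₀ + 1)) * (κ / ε ^ 2)) := by
  have hn0 : (0 : ℝ) < n := by exact_mod_cast hn
  have : Nonempty (Fin n) := ⟨⟨0, hn⟩⟩
  have hXm : ∀ i, Measurable (X i) := fun i => (hX i).measurable
  obtain ⟨N, hNT, hNcard, hNnet⟩ := exists_net hT (w := fun _ : Fin n => (1 : ℝ))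
    (fun _ => zero_le_one) (by simpa using hn) i₀
  simp only [Finset.sum_const, nsmul_eq_mul, mul_one, Finset.card_univ, Fintype.card_fin] at hNnet
  set D : Ω → ℝ≥0∞ := fun ω => ⨆ p : {p : Finset (Fin n) × Finset (Fin n) //
    (p.1 ∈ T ∧ p.2 ∈ T) ∧ ((symmDiff p.1 p.2).card : ℝ) ≤ (2⁻¹ : ℝ) ^ i₀ * n},
        ‖∑ i ∈ p.1.1, X i ω - ∑ i ∈ p.1.2, X i ω‖ₑ with hD
  have hDm : Measurable D := .iSup fun p => by fun_prop
  have hDle := lintegral_iSup_enorm_sub_le hXm hind (fun i => (hX i).integrable)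
    (fun i => (hX i).centered) hc hη (fun i => (hX i).tail_le) hT i₀
  rw [Fintype.card_fin] at hDle
  have hsub : {ω | ∃ J ∈ T, 3 * ε ≤ deviation (fun i => X i ω) J}
      ⊆ {ω | ENNReal.ofReal (√n * ε) ≤ D ω}
        ∪ ⋃ J ∈ N, {ω | ε ≤ deviation (fun i => X i ω) J} := by
    rintro ω ⟨J, hJ, hJdev⟩
    by_contra hcon
    simp only [Set.mem_union, Set.mem_iUnion, Set.mem_ofPred_eq, not_or, not_le, not_exists] at hcon
    obtain ⟨hcon1, hcon2⟩ := hcon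
    obtain ⟨J', hJ', hclose⟩ := hNnet J hJ
    have h1 : (√n)⁻¹ * ‖∑ i ∈ J, X i ω - ∑ i ∈ J', X i ω‖ < ε := by
      have h2 : ‖∑ i ∈ J, X i ω - ∑ i ∈ J', X i ω‖ₑ ≤ D ω :=
        le_iSup (fun p : {p : Finset (Fin n) × Finset (Fin n) // (p.1 ∈ T ∧ p.2 ∈ T) ∧
          ((symmDiff p.1 p.2).card : ℝ) ≤ (2⁻¹ : ℝ) ^ i₀ * n} =>
          ‖∑ i ∈ p.1.1, X i ω - ∑ i ∈ p.1.2, X i ω‖ₑ)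
          ⟨(J, J'), ⟨hJ, hNT hJ'⟩, hclose⟩
      have h3 := h2.trans_lt hcon1
      rw [← ofReal_norm, ENNReal.ofReal_lt_ofReal_iff (by positivity)] at h3
      rwa [inv_mul_lt_iff₀ (by positivity)]
    have h2 := hcon2 J' hJ'
    exact hJdev.not_gt (deviation_lt_of_net hn0 hclose hi₀ h1 h2)
  refine (measure_mono hsub).trans ((measure_union_le _ _).trans (add_le_add ?_ ?_))
  · refine (meas_ge_le_lintegral_div hDm.aemeasurable (by
      rw [Ne, ENNReal.ofReal_eq_zero, not_le]; positivity) ENNReal.ofReal_ne_top).trans ?_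
    refine (ENNReal.div_le_div_right hDle _).trans (le_of_eq ?_)
    rw [← ENNReal.ofReal_ofNat, ← ENNReal.ofReal_mul (by norm_num),
      ← ENNReal.ofReal_div_of_pos (by positivity)]
    congr 1
    field_simp
  · refine (measure_biUnion_finset_le N _).trans ?_
    refine (Finset.sum_le_sum fun J _ => measure_le_deviation_le hXm hn hε J (hκ J)).trans ?_
    rw [Finset.sum_const, nsmul_eq_mul, ENNReal.ofReal_mul (Real.exp_pos _).le]
    gcongr
    rw [← ENNReal.ofReal_natCast]
    exact ENNReal.ofReal_le_ofReal hNcard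

end Deviation

theorem IncrementConditions.exists_truncation_level {Ω : Type*} [MeasurableSpace Ω]
    {P : Measure Ω} {ξ : (d : ℕ) → Ω → EuclideanSpace ℝ (Fin d)} (hξ : IncrementConditions P ξ)
    {η : ℝ} (hη : 0 < η) : ∃ c : ℝ, 0 < c ∧
      ∀ d, ∫⁻ ω in {ω | c < ‖ξ d ω‖ ^ 2}, ENNReal.ofReal (‖ξ d ω‖ ^ 2) ∂P ≤ ENNReal.ofReal η := by
  have h1 := ENNReal.tendsto_nhds_zero.1 hξ.uniformlyIntegrable (ENNReal.ofReal η)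
    (ENNReal.ofReal_pos.2 hη)
  obtain ⟨c, hc, hc0⟩ := (h1.and (eventually_gt_atTop 0)).exists
  exact ⟨c, hc0, fun d => (le_iSup (fun d => ∫⁻ ω in {ω | c < ‖ξ d ω‖ ^ 2},
    ENNReal.ofReal (‖ξ d ω‖ ^ 2) ∂P) d).trans hc⟩

/-- The conditions concern the law only, so they pass from `ξ d` to the increments. -/
theorem IncrementConditions.eventually_isIncrement {Ω : Type*} [MeasurableSpace Ω]
    {P : Measure Ω} {ξ : (d : ℕ) → Ω → EuclideanSpace ℝ (Fin d)} (hξ : IncrementConditions P ξ)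
    {τ c η : ℝ} (hτ : 0 < τ)
    (hc : ∀ d, ∫⁻ ω in {ω | c < ‖ξ d ω‖ ^ 2}, ENNReal.ofReal (‖ξ d ω‖ ^ 2) ∂P ≤ ENNReal.ofReal η) :
    ∀ᶠ d in atTop, ∀ Z : Ω → EuclideanSpace ℝ (Fin d), Measurable Z →
      IdentDistrib Z (ξ d) P P → IsIncrement P τ c η Z := by
  filter_upwards [hξ.negligible.eventually_lt_const hτ, eventually_ge_atTop 1]
    with d hd hd1 Z hZ hid
  refine ⟨hZ, ?_, ?_, fun a a' h => ?_, fun a => ?_, ?_⟩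
  · rw [hid.integral_eq, hξ.centered d hd1]
  · have := (hid.comp (u := fun x => ‖x‖ ^ 2) (by fun_prop)).integral_eq
    exact this.trans (hξ.normalized d hd1)
  · have := (hid.comp (u := fun x => x a * x a') (by fun_prop)).integral_eq
    exact this.trans (hξ.uncorrelated d a a' h)
  · have := (hid.comp (u := fun x => x a ^ 2) (by fun_prop)).integral_eq
    refine this.le.trans (le_trans ?_ hd.le)
    exact le_ciSup (f := fun a : Fin d => ∫ ω, (ξ d ω a) ^ 2 ∂P) (Set.finite_range _).bddAbove a
  · have hS : MeasurableSet {x : EuclideanSpace ℝ (Fin d) | c < ‖x‖ ^ 2} :=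
      measurableSet_lt measurable_const (by fun_prop)
    have h1 := (hid.comp (u := {x : EuclideanSpace ℝ (Fin d) | c < ‖x‖ ^ 2}.indicator
      fun x => ENNReal.ofReal (‖x‖ ^ 2)) (Measurable.indicator (by fun_prop) hS)).lintegral_eq
    have h2 := hc d
    have h3 : NullMeasurableSet {ω | c < ‖ξ d ω‖ ^ 2} P :=
      hid.aemeasurable_snd.nullMeasurableSet_preimage hS
    have h4 : MeasurableSet {ω | c < ‖Z ω‖ ^ 2} := hZ hS
    rw [← lintegral_indicator₀ h3] at h2
    rw [← lintegral_indicator h4]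
    exact h1.le.trans h2

/-- Deviations over deterministic families of bounded VC dimension, uniformly in the family. Two
truncation levels are needed: the first one fixes the scale of the net, and the second one is
chosen in terms of the cardinality of that net. -/
theorem IncrementConditions.eventually_measure_exists_le_deviation_le {Ω : Type*}
    [MeasurableSpace Ω] {P : Measure Ω} [IsProbabilityMeasure P]
    {ξ : (d : ℕ) → Ω → EuclideanSpace ℝ (Fin d)} (hξ : IncrementConditions P ξ)
    {X : (d : ℕ) → ℕ → Ω → EuclideanSpace ℝ (Fin d)} (hX : ∀ d j, Measurable (X d j))
    (hid : ∀ d j, IdentDistrib (X d j) (ξ d) P P) (hind : ∀ d, iIndepFun (X d) P)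
    {n : ℕ → ℕ} (hn : Tendsto n atTop atTop) (k : ℕ) {ε δ : ℝ} (hε : 0 < ε) (hδ : 0 < δ) :
    ∀ᶠ d in atTop, ∀ T : Finset (Finset (Fin (n d))), T.vcDim ≤ k →
      P {ω | ∃ J ∈ T, 3 * ε ≤ deviation (fun i : Fin (n d) => X d i ω) J} ≤ ENNReal.ofReal δ := by
  set φ := chainingModulus k with hφ
  have hφnn : ∀ i, 0 ≤ φ i := fun i => chainingModulus_nonneg k i
  -- the truncation error in the equicontinuity bound
  obtain ⟨η, hη, hηle⟩ : ∃ η : ℝ, 0 < η ∧ φ 0 * √η ≤ δ * ε / 8 := by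
    set r := δ * ε / 8 / (φ 0 + 1) with hr
    have hφ0 := hφnn 0
    refine ⟨r ^ 2, by positivity, ?_⟩
    rw [Real.sqrt_sq (by positivity), hr, mul_div_assoc', div_le_iff₀ (by positivity)]
    have : 0 < δ * ε / 8 := by positivity
    nlinarith
  obtain ⟨c, hc, hcη⟩ := hξ.exists_truncation_level hη
  -- the scale of the net
  obtain ⟨i₀, hi₀, hi₀'⟩ : ∃ i₀ : ℕ, φ i₀ * √c ≤ δ * ε / 8 ∧ √((2⁻¹ : ℝ) ^ i₀) ≤ ε := by
    have h1 : Tendsto (fun i => φ i * √c) atTop (𝓝 0) := by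
      simpa using (tendsto_chainingModulus k).mul_const √c
    have h2 : Tendsto (fun i : ℕ => √((2⁻¹ : ℝ) ^ i)) atTop (𝓝 0) := by
      have := (Real.continuous_sqrt.tendsto 0).comp
        (tendsto_pow_atTop_nhds_zero_of_lt_one (r := (2⁻¹ : ℝ)) (by norm_num) (by norm_num))
      rwa [Real.sqrt_zero] at this
    obtain ⟨i, h3, h4⟩ := ((h1.eventually_lt_const (show 0 < δ * ε / 8 by positivity)).and
      (h2.eventually_lt_const hε)).exists
    exact ⟨i, h3.le, h4.le⟩
  -- the accuracy on the net
  set N := Real.exp (entropyConst k * (i₀ + 1)) with hN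
  have hN0 : 0 < N := Real.exp_pos _
  set κ := δ * ε ^ 2 / (2 * N) with hκ
  have hκ0 : 0 < κ := by positivity
  obtain ⟨c₂, hc₂, hcη₂⟩ := hξ.exists_truncation_level (η := κ / 6) (by positivity)
  have hτ : 0 < (κ / 3) ^ 2 / 2 := by positivity
  have hnn : Tendsto (fun d => c₂ / √(n d)) atTop (𝓝 0) :=
    tendsto_const_nhds.div_atTop (Real.tendsto_sqrt_atTop.comp
      (tendsto_natCast_atTop_atTop.comp hn))
  filter_upwards [hξ.eventually_isIncrement hτ hcη, hξ.eventually_isIncrement hτ hcη₂,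
    hn.eventually_gt_atTop 0, hnn.eventually_lt_const (show 0 < κ / 3 by positivity)]
    with d hd hd₂ hnd hnd' T hT
  have hnd0 : (0 : ℝ) < n d := by exact_mod_cast hnd
  have hindn : iIndepFun (fun (i : Fin (n d)) => X d i) P :=
    (hind d).precomp Fin.val_injective
  refine (measure_exists_le_deviation_le (κ := κ) (X := fun i : Fin (n d) => X d i)
    (fun i => hd _ (hX d i) (hid d i)) hindn hc hη hnd hε (fun J => ?_) hT hi₀').trans ?_
  · refine (lintegral_abs_sq_norm_sum_sub_card_le (X := fun i : Fin (n d) => X d i)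
      (fun i => hd₂ _ (hX d i) (hid d i)) hindn hτ hc₂ (by positivity) J hnd
      (card_finset_fin_le J)).trans (ENNReal.ofReal_le_ofReal ?_)
    rw [show 2 * ((κ / 3) ^ 2 / 2) = (κ / 3) ^ 2 by ring, Real.sqrt_sq (by positivity)]
    have h1 : c₂ * √(n d) = n d * (c₂ / √(n d)) := by
      rw [mul_div_assoc', eq_div_iff (by positivity), mul_assoc, Real.mul_self_sqrt hnd0.le,
        mul_comm]
    rw [h1, ← mul_add]
    refine mul_le_mul_of_nonneg_left ?_ hnd0.le
    linarith
  · rw [← ENNReal.ofReal_add (by have := hφnn i₀; have := hφnn 0; positivity) (by positivity)]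
    refine ENNReal.ofReal_le_ofReal ?_
    have h1 : N * (κ / ε ^ 2) = δ / 2 := by
      rw [hκ]; field_simp
    have h2 : 2 * (φ i₀ * √c + φ 0 * √η) / ε ≤ δ / 2 := by
      rw [div_le_iff₀ hε]
      linarith
    linarith

/-! ### Measurability of the traces and conditioning on the sample -/

theorem measurePreserving_comp_equiv {𝕏 ι ι' : Type*} [MeasurableSpace 𝕏] [Fintype ι] [Fintype ι']
    (μ : Measure 𝕏) [IsProbabilityMeasure μ] (e : ι ≃ ι') :
    MeasurePreserving (fun v : ι' → 𝕏 => v ∘ e) (Measure.pi fun _ => μ)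
      (Measure.pi fun _ => μ) := by
  convert measurePreserving_piCongrLeft (α := fun _ : ι => 𝕏) (fun _ => μ) e.symm using 1
  ext v i
  rw [MeasurableEquiv.coe_piCongrLeft, Function.comp_apply]
  conv_rhs => rw [← e.symm_apply_apply i, Equiv.piCongrLeft_apply_apply]

theorem nullMeasurableSet_traces_eq {𝕏 ι : Type*} [MeasurableSpace 𝕏] [Fintype ι]
    {μ : Measure 𝕏} [IsProbabilityMeasure μ] {𝓜 : Set (Set 𝕏)} (h : IsSampleMeasurable 𝓜 μ)
    (T : Finset (Finset ι)) :
    NullMeasurableSet {u : ι → 𝕏 | traces 𝓜 u = T} (Measure.pi fun _ => μ) := by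
  classical
  have hmem : ∀ J : Finset ι,
      NullMeasurableSet {u : ι → 𝕏 | J ∈ traces 𝓜 u} (Measure.pi fun _ => μ) := fun J => by
    let e := (Fintype.equivFin ι).symm
    have h1 := (h _ (e ⁻¹' (J : Set ι))).preimage
      (measurePreserving_comp_equiv μ e).quasiMeasurePreserving
    convert h1 using 1
    ext u
    rw [Set.mem_ofPred_eq, mem_traces, Set.mem_preimage, Set.mem_ofPred_eq]
    refine exists_congr fun A => and_congr_right fun _ => ?_
    exact (e.surjective.preimage_injective.eq_iff (a := {i | u i ∈ A}) (b := (J : Set ι))).symm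
  have heq : {u : ι → 𝕏 | traces 𝓜 u = T}
      = ⋂ J, if J ∈ T then {u : ι → 𝕏 | J ∈ traces 𝓜 u} else {u : ι → 𝕏 | J ∈ traces 𝓜 u}ᶜ := by
    ext u
    rw [Set.mem_ofPred_eq, Finset.ext_iff, Set.mem_iInter]
    refine forall_congr' fun J => ?_
    by_cases hJ : J ∈ T <;> simp [hJ]
  rw [heq]
  refine .iInter fun J => ?_
  split_ifs
  · exact hmem J
  · exact (hmem J).compl

/-- A bound that holds for each possible family of traces holds for the random one, when the
traces are those of an independent sample. -/
theorem measure_mem_traces_le {Ω 𝕏 α ι : Type*} [MeasurableSpace Ω] [MeasurableSpace 𝕏]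
    [MeasurableSpace α] [Fintype ι] {P : Measure Ω} {μ : Measure 𝕏} [IsProbabilityMeasure μ]
    {𝓜 : Set (Set 𝕏)} (h : IsSampleMeasurable 𝓜 μ) {X : Ω → α} {U : Ω → ι → 𝕏}
    (hU : Measurable U) (hlaw : P.map U = Measure.pi fun _ => μ)
    (hXU : IndepFun X U P) {G : Finset (Finset ι) → Set α} (hG : ∀ T, MeasurableSet (G T))
    {δ : ℝ≥0∞} (hδ : ∀ u, P (X ⁻¹' G (traces 𝓜 u)) ≤ δ) :
    P {ω | X ω ∈ G (traces 𝓜 (U ω))} ≤ δ := by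
  classical
  set ρ : Measure (ι → 𝕏) := Measure.pi fun _ => μ with hρ
  set C : Finset (Finset ι) → Set (ι → 𝕏) := fun T => {u | traces 𝓜 u = T} with hC
  have hCm : ∀ T, NullMeasurableSet (C T) ρ := fun T => nullMeasurableSet_traces_eq h T
  have hsub : {ω | X ω ∈ G (traces 𝓜 (U ω))}
      ⊆ ⋃ T ∈ (Finset.univ : Finset (Finset (Finset ι))),
        (X ⁻¹' G T ∩ U ⁻¹' toMeasurable ρ (C T)) := fun ω hω =>
    Set.mem_biUnion (Finset.mem_univ (traces 𝓜 (U ω))) ⟨hω, subset_toMeasurable ρ _ rfl⟩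
  have hterm : ∀ T, P (X ⁻¹' G T ∩ U ⁻¹' toMeasurable ρ (C T)) ≤ δ * ρ (C T) := fun T => by
    rw [hXU.measure_inter_preimage_eq_mul _ _ (hG T) (measurableSet_toMeasurable _ _),
      ← Measure.map_apply hU (measurableSet_toMeasurable _ _), hlaw, measure_toMeasurable]
    rcases (C T).eq_empty_or_nonempty with hT | ⟨u, rfl⟩
    · simp [hT]
    · gcongr
      exact hδ u
  have hdisj : Set.Pairwise (Finset.univ : Finset (Finset (Finset ι)))
      (Function.onFun (AEDisjoint ρ) C) := fun T _ T' _ hne =>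
    (Set.disjoint_left.2 fun u hu hu' => hne (hu.symm.trans hu')).aedisjoint
  calc P {ω | X ω ∈ G (traces 𝓜 (U ω))}
      ≤ ∑ T, P (X ⁻¹' G T ∩ U ⁻¹' toMeasurable ρ (C T)) :=
        (measure_mono hsub).trans (measure_biUnion_finset_le _ _)
    _ ≤ ∑ T, δ * ρ (C T) := Finset.sum_le_sum fun T _ => hterm T
    _ = δ * ρ (⋃ T ∈ (Finset.univ : Finset (Finset (Finset ι))), C T) := by
        rw [← Finset.mul_sum, measure_biUnion_finset₀ hdisj fun T _ => hCm T]
    _ ≤ δ * 1 := by gcongr; exact prob_le_one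
    _ = δ := mul_one δ

/-! ### The uniform law of large numbers over a Vapnik–Chervonenkis class -/

/-- For two samples `v ∘ Sum.inl` and `v ∘ Sum.inr` and signs `σ`, the largest absolute value of
`∑ i, σ i * (𝟙 A (v (inl i)) - 𝟙 A (v (inr i)))` over `A ∈ 𝓜`, written in terms of the traces. -/
noncomputable def ghostSup {n : ℕ} (T : Finset (Finset (Fin n ⊕ Fin n))) (σ : Fin n → ℤˣ) :
    ℝ≥0∞ :=
  ⨆ J ∈ T, ‖signedSum σ fun i =>
    (J : Set (Fin n ⊕ Fin n)).indicator (1 : Fin n ⊕ Fin n → ℝ) (.inl i)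
      - (J : Set (Fin n ⊕ Fin n)).indicator (1 : Fin n ⊕ Fin n → ℝ) (.inr i)‖ₑ

/-- The exchange of the two samples at the indices with negative sign. -/
def swapEquiv {n : ℕ} (σ : Fin n → ℤˣ) : Fin n ⊕ Fin n ≃ Fin n ⊕ Fin n :=
  Function.Involutive.toPerm
    (Sum.elim (fun i => if σ i = 1 then .inl i else .inr i)
      fun i => if σ i = 1 then .inr i else .inl i)
    (by rintro (i | i) <;> by_cases h : σ i = 1 <;> simp [h])

theorem ghostSup_traces_comp_swapEquiv_le {𝕏 : Type*} (𝓜 : Set (Set 𝕏)) {n : ℕ} (σ : Fin n → ℤˣ)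
    (v : Fin n ⊕ Fin n → 𝕏) :
    ghostSup (traces 𝓜 (v ∘ swapEquiv σ)) 1 ≤ ghostSup (traces 𝓜 v) σ := by
  refine iSup₂_le fun J hJ => ?_
  obtain ⟨A, hA, hAJ⟩ := mem_traces.1 hJ
  obtain ⟨J', hJ', hAJ'⟩ := exists_mem_traces v hA
  refine le_trans (le_of_eq ?_) (le_iSup₂ J' hJ')
  have hmem : ∀ a, a ∈ J ↔ swapEquiv σ a ∈ J' := fun a => by
    rw [hAJ', ← Finset.mem_coe, ← hAJ]; rfl
  congr 1
  refine Finset.sum_congr rfl fun i _ => ?_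
  have hl : swapEquiv σ (.inl i) = if σ i = 1 then .inl i else .inr i := rfl
  have hr : swapEquiv σ (.inr i) = if σ i = 1 then .inr i else .inl i := rfl
  rcases Int.units_eq_one_or (σ i) with h | h <;>
    simp [Set.indicator_apply, hmem, hl, hr, h]

/-- A bound on the expected supremum, over the class, of the difference between the numbers of
points of two samples of size `n` in a set; `2 * n + 1` to the power `k` bounds the number of
traces on the two samples. -/
noncomputable def ghostBound (k n : ℕ) : ℝ := √n * (Real.log (2 * (2 * n + 1) ^ k) + 1 / 2)

theorem sum_ghostSup_le {n k : ℕ} (hn : 0 < n) {T : Finset (Finset (Fin n ⊕ Fin n))}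
    (hT : T.vcDim ≤ k) :
    ∑ σ, ghostSup T σ ≤ Fintype.card (Fin n → ℤˣ) * ENNReal.ofReal (ghostBound k n) := by
  rcases T.eq_empty_or_nonempty with rfl | ⟨J₀, hJ₀⟩
  · simp [ghostSup]
  have hn0 : (0 : ℝ) < n := by exact_mod_cast hn
  have hsn : 0 < √(n : ℝ) := Real.sqrt_pos.2 hn0
  have hcard : (T.card : ℝ) ≤ (2 * n + 1) ^ k := by
    have := card_le_pow_of_vcDim_le hT
    rw [Fintype.card_sum, Fintype.card_fin, ← two_mul] at this
    exact_mod_cast this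
  obtain ⟨M, hM, hMle⟩ := exists_majorant_of_card_le T
    (fun J i => (J : Set (Fin n ⊕ Fin n)).indicator (1 : Fin n ⊕ Fin n → ℝ) (.inl i)
      - (J : Set (Fin n ⊕ Fin n)).indicator (1 : Fin n ⊕ Fin n → ℝ) (.inr i))
    (lam := (√n)⁻¹) (v := n) (m := (2 * n + 1) ^ k) (inv_pos.2 hsn)
    (one_le_pow₀ (by linarith)) hcard (fun J _ => by
      calc _ ≤ ∑ _i : Fin n, (1 : ℝ) := Finset.sum_le_sum fun i _ => by
            by_cases h : (Sum.inl i : Fin n ⊕ Fin n) ∈ J <;>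
              by_cases h' : (Sum.inr i : Fin n ⊕ Fin n) ∈ J <;> simp [h, h']
        _ = n := by simp)
  set c : ℕ := Fintype.card (Fin n → ℤˣ) with hc
  have hc0 : 0 < c := Fintype.card_pos
  calc ∑ σ, ghostSup T σ ≤ ∑ σ : Fin n → ℤˣ, ENNReal.ofReal (M σ) :=
        Finset.sum_le_sum fun σ _ => iSup₂_le fun J hJ => by
          rw [← ofReal_norm]; exact ENNReal.ofReal_le_ofReal (hM σ J hJ)
    _ = ENNReal.ofReal (∑ σ : Fin n → ℤˣ, M σ) :=
        (ENNReal.ofReal_sum_of_nonneg fun σ _ => (norm_nonneg _).trans (hM σ J₀ hJ₀)).symm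
    _ ≤ ENNReal.ofReal (c * ghostBound k n) := by
        refine ENNReal.ofReal_le_ofReal ?_
        rw [Fintype.expect_eq_sum_div_card, ← hc, div_le_iff₀' (by exact_mod_cast hc0)] at hMle
        refine hMle.trans (le_of_eq ?_)
        rw [ghostBound, div_inv_eq_mul]
        congr 1
        have : (√(n : ℝ))⁻¹ * n = √n := by
          rw [inv_mul_eq_iff_eq_mul₀ hsn.ne', Real.mul_self_sqrt hn0.le]
        rw [this]
        ring
    _ = _ := by rw [ENNReal.ofReal_mul (Nat.cast_nonneg _), ENNReal.ofReal_natCast]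

theorem aemeasurable_comp_traces {𝕏 ι : Type*} [MeasurableSpace 𝕏] [Fintype ι]
    {μ : Measure 𝕏} [IsProbabilityMeasure μ] {𝓜 : Set (Set 𝕏)} (h : IsSampleMeasurable 𝓜 μ)
    (g : Finset (Finset ι) → ℝ≥0∞) :
    AEMeasurable (fun u : ι → 𝕏 => g (traces 𝓜 u)) (Measure.pi fun _ => μ) := by
  classical
  refine NullMeasurable.aemeasurable fun s _ => ?_
  have heq : (fun u : ι → 𝕏 => g (traces 𝓜 u)) ⁻¹' s
      = ⋃ T : {T : Finset (Finset ι) // g T ∈ s}, {u : ι → 𝕏 | traces 𝓜 u = T} := by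
    ext u
    simp
  rw [heq]
  exact .iUnion fun T => nullMeasurableSet_traces_eq h _

/-- Exchanging the two samples at any set of indices does not change their joint law, so the
expected deviation between the two samples is at most its average over all signs. -/
theorem lintegral_ghostSup_le {𝕏 : Type*} [MeasurableSpace 𝕏] {μ : Measure 𝕏}
    [IsProbabilityMeasure μ] {𝓜 : Set (Set 𝕏)} (h : IsSampleMeasurable 𝓜 μ) {k : ℕ}
    (hk : ∀ I : Finset 𝕏, I.card = k + 1 → ¬ Shatters 𝓜 I) {n : ℕ} (hn : 0 < n) :
    ∫⁻ v : Fin n ⊕ Fin n → 𝕏, ghostSup (traces 𝓜 v) 1 ∂(Measure.pi fun _ => μ)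
      ≤ ENNReal.ofReal (ghostBound k n) := by
  set ρ : Measure (Fin n ⊕ Fin n → 𝕏) := Measure.pi fun _ => μ with hρ
  set c : ℕ := Fintype.card (Fin n → ℤˣ) with hc
  have hc0 : (c : ℝ≥0∞) ≠ 0 := by exact_mod_cast (Fintype.card_pos (α := Fin n → ℤˣ)).ne'
  have hswap : ∀ σ : Fin n → ℤˣ, ∫⁻ v, ghostSup (traces 𝓜 v) 1 ∂ρ
      ≤ ∫⁻ v, ghostSup (traces 𝓜 v) σ ∂ρ := fun σ => by
    have hmp := measurePreserving_comp_equiv (𝕏 := 𝕏) μ (swapEquiv σ)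
    have hae := aemeasurable_comp_traces (μ := μ) h
      (fun T : Finset (Finset (Fin n ⊕ Fin n)) => ghostSup T 1)
    have h1 : ∫⁻ v, ghostSup (traces 𝓜 v) 1 ∂ρ
        = ∫⁻ v, ghostSup (traces 𝓜 (v ∘ swapEquiv σ)) 1 ∂ρ := by
      conv_lhs => rw [hρ, ← hmp.map_eq]
      exact lintegral_map' (by rwa [hmp.map_eq]) hmp.measurable.aemeasurable
    rw [h1]
    exact lintegral_mono fun v => ghostSup_traces_comp_swapEquiv_le 𝓜 σ v
  have hmul : (c : ℝ≥0∞) * ∫⁻ v, ghostSup (traces 𝓜 v) 1 ∂ρ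
      ≤ c * ENNReal.ofReal (ghostBound k n) := by
    calc _ = ∑ _σ : Fin n → ℤˣ, ∫⁻ v, ghostSup (traces 𝓜 v) 1 ∂ρ := by
          rw [Finset.sum_const, nsmul_eq_mul, Finset.card_univ]
      _ ≤ ∑ σ : Fin n → ℤˣ, ∫⁻ v, ghostSup (traces 𝓜 v) σ ∂ρ :=
          Finset.sum_le_sum fun σ _ => hswap σ
      _ = ∫⁻ v, ∑ σ : Fin n → ℤˣ, ghostSup (traces 𝓜 v) σ ∂ρ :=
          (lintegral_finsetSum' _ fun σ _ =>
            aemeasurable_comp_traces (μ := μ) h fun T => ghostSup T σ).symm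
      _ ≤ ∫⁻ _v, c * ENNReal.ofReal (ghostBound k n) ∂ρ :=
          lintegral_mono fun v => sum_ghostSup_le hn (vcDim_traces_le hk v)
      _ = _ := by rw [lintegral_const, measure_univ, mul_one]
  exact (ENNReal.mul_le_mul_iff_right hc0 (ENNReal.natCast_ne_top c)).1 hmul

/-- The Glivenko–Cantelli property in outer probability: the deviations from the mean are at most
the conditional expectation, given the sample, of the deviations from an independent sample. -/
theorem measure_exists_le_abs_card_sub_le {𝕏 : Type*} [MeasurableSpace 𝕏] {μ : Measure 𝕏}
    [IsProbabilityMeasure μ] {𝓜 : Set (Set 𝕏)} (hm : ∀ A ∈ 𝓜, MeasurableSet A)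
    (h : IsSampleMeasurable 𝓜 μ) {k : ℕ}
    (hk : ∀ I : Finset 𝕏, I.card = k + 1 → ¬ Shatters 𝓜 I) {n : ℕ} (hn : 0 < n) {ε : ℝ}
    (hε : 0 < ε) :
    (Measure.pi fun _ : Fin n => μ) {u | ∃ A ∈ 𝓜,
        ε ≤ |(∑ i, A.indicator (1 : 𝕏 → ℝ) (u i)) / n - μ.real A|}
      ≤ ENNReal.ofReal (ghostBound k n / (n * ε)) := by
  have hn0 : (0 : ℝ) < n := by exact_mod_cast hn
  set ρ : Measure (Fin n → 𝕏) := Measure.pi fun _ => μ with hρ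
  have hmp := measurePreserving_sumPiEquivProdPi_symm (ι := Fin n) (ι' := Fin n)
    (X := fun _ => 𝕏) (fun _ => μ)
  set e := (MeasurableEquiv.sumPiEquivProdPi fun _ : Fin n ⊕ Fin n => 𝕏).symm with he
  set H : (Fin n → 𝕏) × (Fin n → 𝕏) → ℝ≥0∞ := fun p => ghostSup (traces 𝓜 (e p)) 1 with hH
  have hHm : AEMeasurable H (ρ.prod ρ) :=
    (aemeasurable_comp_traces (μ := μ) h (fun T : Finset (Finset (Fin n ⊕ Fin n)) =>
      ghostSup T 1)).comp_quasiMeasurePreserving hmp.quasiMeasurePreserving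
  have hHint : ∫⁻ u, ∫⁻ u', H (u, u') ∂ρ ∂ρ ≤ ENNReal.ofReal (ghostBound k n) := by
    rw [← lintegral_prod _ hHm]
    refine le_trans (le_of_eq ?_) (lintegral_ghostSup_le (μ := μ) h hk hn)
    exact hmp.lintegral_comp_emb e.measurableEmbedding fun v => ghostSup (traces 𝓜 v) 1
  have hsub : {u : Fin n → 𝕏 | ∃ A ∈ 𝓜,
        ε ≤ |(∑ i, A.indicator (1 : 𝕏 → ℝ) (u i)) / n - μ.real A|}
      ⊆ {u | ENNReal.ofReal (n * ε) ≤ ∫⁻ u', H (u, u') ∂ρ} := by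
    rintro u ⟨A, hA, hAε⟩
    set s : (Fin n → 𝕏) → ℝ := fun u => ∑ i, A.indicator (1 : 𝕏 → ℝ) (u i) with hs
    have hcoord : ∀ i, Integrable (fun u' : Fin n → 𝕏 => A.indicator (1 : 𝕏 → ℝ) (u' i)) ρ :=
      fun i => integrable_comp_eval (μ := fun _ : Fin n => μ) (i := i)
        ((integrable_const (1 : ℝ)).indicator (hm A hA))
    have hsint : Integrable s ρ := integrable_finsetSum _ fun i _ => hcoord i
    have hsmean : ∫ u', s u' ∂ρ = n * μ.real A := by
      rw [hs, integral_finsetSum _ fun i _ => hcoord i]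
      have : ∀ i, ∫ u' : Fin n → 𝕏, A.indicator (1 : 𝕏 → ℝ) (u' i) ∂ρ = μ.real A := fun i => by
        rw [← integral_indicator_one (hm A hA)]
        exact integral_comp_eval (μ := fun _ : Fin n => μ) (i := i)
          (((measurable_one (α := ℝ)).indicator (hm A hA)).aestronglyMeasurable)
      simp_rw [this]
      simp
    have hle : ∀ u', ‖s u - s u'‖ₑ ≤ H (u, u') := fun u' => by
      obtain ⟨J, hJ, hAJ⟩ := exists_mem_traces (e (u, u')) hA
      refine le_trans (le_of_eq ?_) (le_iSup₂ J hJ)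
      congr 1
      rw [hs, ← Finset.sum_sub_distrib]
      refine Finset.sum_congr rfl fun i _ => ?_
      have hind : ∀ a, (J : Set (Fin n ⊕ Fin n)).indicator (1 : Fin n ⊕ Fin n → ℝ) a
          = A.indicator (1 : 𝕏 → ℝ) (e (u, u') a) := fun a => by
        by_cases ha : a ∈ J
        · simp [ha, (hAJ a).1 ha]
        · simp [ha, mt (hAJ a).2 ha]
      have hl : e (u, u') (.inl i) = u i := rfl
      have hr : e (u, u') (.inr i) = u' i := rfl
      simp [hind, hl, hr]
    calc ENNReal.ofReal (n * ε) ≤ ENNReal.ofReal |s u - n * μ.real A| := by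
          refine ENNReal.ofReal_le_ofReal ?_
          have h1 : s u - n * μ.real A = n * (s u / n - μ.real A) := by field_simp
          rw [h1, abs_mul, abs_of_pos hn0]
          exact mul_le_mul_of_nonneg_left hAε hn0.le
      _ = ‖∫ u', (s u - s u') ∂ρ‖ₑ := by
          rw [integral_sub (integrable_const _) hsint, hsmean, integral_const, probReal_univ,
            one_smul, ← ofReal_norm, Real.norm_eq_abs]
      _ ≤ ∫⁻ u', ‖s u - s u'‖ₑ ∂ρ := enorm_integral_le_lintegral_enorm _
      _ ≤ ∫⁻ u', H (u, u') ∂ρ := lintegral_mono hle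
  refine (measure_mono hsub).trans ((meas_ge_le_lintegral_div hHm.lintegral_prod_right' (by
    rw [Ne, ENNReal.ofReal_eq_zero, not_le]; positivity) ENNReal.ofReal_ne_top).trans ?_)
  refine (ENNReal.div_le_div_right hHint _).trans (le_of_eq ?_)
  rw [← ENNReal.ofReal_div_of_pos (by positivity)]

theorem tendsto_ghostBound_div (k : ℕ) {ε : ℝ} (hε : 0 < ε) :
    Tendsto (fun n : ℕ => ghostBound k n / (n * ε)) atTop (𝓝 0) := by
  have hlim : Tendsto (fun n : ℕ => (2 + 4 * k) / ε / √√(n : ℝ)) atTop (𝓝 0) :=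
    tendsto_const_nhds.div_atTop (Real.tendsto_sqrt_atTop.comp
      (Real.tendsto_sqrt_atTop.comp tendsto_natCast_atTop_atTop))
  refine tendsto_of_tendsto_of_tendsto_of_le_of_le' tendsto_const_nhds hlim ?_ ?_
  · filter_upwards with n
    have : 0 ≤ Real.log (2 * (2 * n + 1) ^ k) := by
      refine Real.log_nonneg ?_
      have : (1 : ℝ) ≤ (2 * n + 1) ^ k :=
        one_le_pow₀ (by linarith [(Nat.cast_nonneg n : (0 : ℝ) ≤ n)])
      linarith
    unfold ghostBound
    positivity
  · filter_upwards [eventually_ge_atTop 1] with n hn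
    have hn1 : (1 : ℝ) ≤ n := by exact_mod_cast hn
    -- with `a = n ^ (1 / 4)`, the logarithm is of order `a` and `√n = a ^ 2`
    set a := √√(n : ℝ) with ha
    have ha1 : 1 ≤ a := Real.one_le_sqrt.2 (Real.one_le_sqrt.2 hn1)
    have ha2 : a ^ 2 = √n := Real.sq_sqrt (Real.sqrt_nonneg _)
    have ha4 : a ^ 4 = n := by
      rw [show a ^ 4 = (a ^ 2) ^ 2 by ring, ha2, Real.sq_sqrt (by linarith)]
    have hlog : Real.log (2 * n + 1) ≤ 4 * a := by
      calc Real.log (2 * n + 1) ≤ Real.log (3 * a ^ 4) :=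
            Real.log_le_log (by linarith) (by rw [ha4]; linarith)
        _ = Real.log 3 + 4 * Real.log a := by
            rw [Real.log_mul (by norm_num) (by positivity), Real.log_pow]
            norm_num
        _ ≤ 4 * a := by
            have h1 := Real.log_le_sub_one_of_pos (show (0 : ℝ) < 3 by norm_num)
            have h2 := Real.log_le_sub_one_of_pos (show 0 < a by linarith)
            linarith
    have hlog' : Real.log (2 * (2 * n + 1) ^ k) + 1 / 2 ≤ (2 + 4 * k) * a := by
      rw [Real.log_mul (by norm_num) (by positivity), Real.log_pow]
      have h1 := Real.log_two_lt_d9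
      have h2 := mul_le_mul_of_nonneg_left hlog (Nat.cast_nonneg k : (0 : ℝ) ≤ k)
      nlinarith
    calc ghostBound k n / (n * ε) ≤ a ^ 2 * ((2 + 4 * k) * a) / (a ^ 4 * ε) := by
          rw [ghostBound, ← ha2, ha4]
          gcongr
      _ = (2 + 4 * k) / ε / a := by
          field_simp

end SetIndexed

/-! ### Convergence of the set-indexed sums -/

/-- The supremum below is over a bounded set of reals for every `ω`, and `TendstoInMeasure` is
convergence in (outer) probability. -/
theorem mainTheorem3
    {Ω 𝕏 : Type*} [MeasurableSpace Ω] [MeasurableSpace 𝕏]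
    (P : Measure Ω) [IsProbabilityMeasure P]
    (μ : Measure 𝕏) [IsProbabilityMeasure μ]
    (𝓜 : Set (Set 𝕏)) (h𝓜_meas : ∀ A ∈ 𝓜, MeasurableSet A)
    (h𝓜_vc : SetIndexed.IsVCClass 𝓜)
    (h𝓜_sample : SetIndexed.IsSampleMeasurable 𝓜 μ)
    (ξ : (d : ℕ) → Ω → EuclideanSpace ℝ (Fin d))
    (hξ : SetIndexed.IncrementConditions P ξ)
    (X : (d : ℕ) → ℕ → Ω → EuclideanSpace ℝ (Fin d))
    (hX_meas : ∀ d j, Measurable (X d j))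
    (hX_ident : ∀ d j, IdentDistrib (X d j) (ξ d) P P)
    (hX_indep : ∀ d, iIndepFun (X d) P)
    (U : ℕ → Ω → 𝕏)
    (hU_meas : ∀ j, Measurable (U j))
    (hU_law : ∀ j, P.map (U j) = μ)
    (hU_indep : iIndepFun U P)
    (hXU_indep : ∀ d, IndepFun (fun ω j => X d j ω) (fun ω j => U j ω) P)
    (n : ℕ → ℕ) (hn : Tendsto n atTop atTop) :
    TendstoInMeasure P
      (fun d ω => ⨆ A : 𝓜,
        |(Real.sqrt (n d))⁻¹ * ‖SetIndexed.setIndexedSum (X d) U (n d) (A : Set 𝕏) ω‖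
          - Real.sqrt (μ.real (A : Set 𝕏))|)
      atTop (fun _ => 0) := by
  obtain ⟨k, hk⟩ := h𝓜_vc
  rw [tendstoInMeasure_iff_norm]
  intro ε hε
  rw [ENNReal.tendsto_nhds_zero]
  intro δ' hδ'
  obtain ⟨δ, hδ, hδδ'⟩ : ∃ δ : ℝ, 0 < δ ∧ ENNReal.ofReal (2 * δ) ≤ δ' := by
    obtain ⟨r, hr0, hr⟩ := ENNReal.lt_iff_exists_nnreal_btwn.1 hδ'
    refine ⟨r / 2, by have : 0 < r := by exact_mod_cast hr0
                      positivity, ?_⟩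
    rw [mul_div_cancel₀ _ two_ne_zero, ENNReal.ofReal_coe_nnreal]
    exact hr.le
  have hε9 : 0 < ε / 9 := by positivity
  have hε3 : 0 < (ε / 3) ^ 2 := by positivity
  filter_upwards [hξ.eventually_measure_exists_le_deviation_le hX_meas hX_ident hX_indep hn k hε9
      hδ, hn.eventually ((SetIndexed.tendsto_ghostBound_div k hε3).eventually_lt_const hδ),
      hn.eventually_gt_atTop 0] with d hdev hghost hnd
  have hnd0 : (0 : ℝ) < n d := by exact_mod_cast hnd
  set V : Ω → Fin (n d) → 𝕏 := fun ω i => U i ω with hV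
  have hVm : Measurable V := measurable_pi_lambda _ fun i => hU_meas i
  have hVlaw : P.map V = Measure.pi fun _ => μ := by
    rw [hV, (iIndepFun_iff_map_fun_eq_pi_map fun i : Fin (n d) => (hU_meas i).aemeasurable).1
      (hU_indep.precomp Fin.val_injective)]
    simp_rw [hU_law]
  set Y : Ω → Fin (n d) → EuclideanSpace ℝ (Fin d) := fun ω i => X d i ω with hY
  have hYV : IndepFun Y V P :=
    (hXU_indep d).comp (φ := fun x (i : Fin (n d)) => x i) (ψ := fun u (i : Fin (n d)) => u i)
      (measurable_pi_lambda _ fun i => measurable_pi_apply _)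
      (measurable_pi_lambda _ fun i => measurable_pi_apply _)
  -- the two exceptional events
  set B₁ : Set Ω := {ω | ∃ J ∈ SetIndexed.traces 𝓜 (V ω),
    3 * (ε / 9) ≤ SetIndexed.deviation (Y ω) J} with hB₁
  set B₂ : Set Ω := V ⁻¹' {u | ∃ A ∈ 𝓜,
    (ε / 3) ^ 2 ≤ |(∑ i, A.indicator (1 : 𝕏 → ℝ) (u i)) / n d - μ.real A|} with hB₂
  have hB₁le : P B₁ ≤ ENNReal.ofReal δ := by
    refine SetIndexed.measure_mem_traces_le h𝓜_sample hVm hVlaw hYV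
      (G := fun T => {x | ∃ J ∈ T, 3 * (ε / 9) ≤ SetIndexed.deviation x J}) (fun T => ?_)
      fun u => hdev _ (SetIndexed.vcDim_traces_le hk u)
    have : {x : Fin (n d) → EuclideanSpace ℝ (Fin d) |
        ∃ J ∈ T, 3 * (ε / 9) ≤ SetIndexed.deviation x J}
        = ⋃ J ∈ T, {x | 3 * (ε / 9) ≤ SetIndexed.deviation x J} := by
      ext x; simp
    rw [this]
    refine Finset.measurableSet_biUnion T fun J _ => measurableSet_le measurable_const ?_
    unfold SetIndexed.deviation
    have : Continuous fun x : Fin (n d) → EuclideanSpace ℝ (Fin d) =>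
        |(√(n d))⁻¹ * ‖∑ i ∈ J, x i‖ - √(J.card / n d)| := by fun_prop
    exact this.measurable
  have hB₂le : P B₂ ≤ ENNReal.ofReal δ := by
    refine (Measure.le_map_apply hVm.aemeasurable _).trans ?_
    rw [hVlaw]
    exact (SetIndexed.measure_exists_le_abs_card_sub_le h𝓜_meas h𝓜_sample hk hnd hε3).trans
      (ENNReal.ofReal_le_ofReal hghost.le)
  refine le_trans (measure_mono (t := B₁ ∪ B₂) fun ω hω => ?_) ((measure_union_le _ _).trans
    ((add_le_add hB₁le hB₂le).trans ?_))
  · by_contra hcon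
    rw [Set.mem_union, not_or] at hcon
    obtain ⟨h1, h2⟩ := hcon
    simp only [hB₁, hB₂, Set.mem_preimage, Set.mem_ofPred_eq, not_exists, not_and, not_le]
      at h1 h2
    have hbound : ∀ A : 𝓜,
        |(√(n d))⁻¹ * ‖SetIndexed.setIndexedSum (X d) U (n d) (A : Set 𝕏) ω‖
          - √(μ.real (A : Set 𝕏))| ≤ 2 * (ε / 3) := by
      rintro ⟨A, hA⟩
      obtain ⟨J, hJ, hJA⟩ := SetIndexed.exists_mem_traces (V ω) hA
      have hsum : SetIndexed.setIndexedSum (X d) U (n d) A ω = ∑ i ∈ J, Y ω i := by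
        classical
        rw [SetIndexed.setIndexedSum, Finset.sum_range, ← Finset.univ_inter J,
          ← Finset.sum_ite_mem]
        refine Finset.sum_congr rfl fun i _ => ?_
        by_cases hi : i ∈ J
        · rw [if_pos hi, Set.indicator_of_mem ((hJA i).1 hi)]
        · rw [if_neg hi, Set.indicator_of_notMem (mt (hJA i).2 hi)]
      have hcard : ∑ i, A.indicator (1 : 𝕏 → ℝ) (V ω i) = J.card := by
        classical
        rw [Finset.card_eq_sum_ones, Nat.cast_sum, ← Finset.univ_inter J, ← Finset.sum_ite_mem]
        refine Finset.sum_congr rfl fun i _ => ?_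
        by_cases hi : i ∈ J
        · simp [hi, (hJA i).1 hi]
        · simp [hi, mt (hJA i).2 hi]
      have h3 := h1 J hJ
      have h4 := h2 A hA
      rw [hcard] at h4
      have h5 : |√(J.card / n d) - √(μ.real A)| ≤ ε / 3 :=
        (SetIndexed.abs_sqrt_sub_sqrt_le (by positivity) measureReal_nonneg).trans
          (Real.sqrt_le_iff.2 ⟨by positivity, h4.le⟩)
      rw [hsum]
      refine (abs_sub_le _ (√(J.card / n d)) _).trans ?_
      unfold SetIndexed.deviation at h3
      linarith
    rw [Set.mem_ofPred_eq, sub_zero, Real.norm_of_nonneg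
      (Real.iSup_nonneg fun A => abs_nonneg _)] at hω
    have := hω.trans (Real.iSup_le hbound (by positivity))
    linarith
  · rw [← ENNReal.ofReal_add hδ.le hδ.le, ← two_mul]
    exact hδδ'
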